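/- **Setting.** Let $\mathbb{R}^n$ carry the Euclidean norm, let $\partial h$ denote the limiting (Mordukhovich) subdifferential of $h$ (the set of limits $v$ of regular subgradients $v^l\in\widehat\partial h(z^l)$ with $z^l\to x$, $h(z^l)\to h(x)$), let $\mathcal N_C$ denote the normal cone of a convex set $C$, and $t_+:=\max\{t,0\}$ (componentwise for vectors). Consider $$\min_{x\in\mathbb{R}^n}F(x):=g_0(x)+\delta_{\mathbb{R}^m_-}(g(x))+\phi(x),\tag{1}$$ where $g=(g_1,\dots,g_m)^\top$, $\Gamma:=\{x: g(x)\in\mathbb{R}^m_-\}\neq\emptyset$; $g_0:\mathbb{R}^n\to(-\infty,\infty]$ is locally Lipschitz and upper-$\mathcal C^2$ at every point of an open convex set $\mathcal O\supset\Gamma$; $g_1,\dots,g_m:\mathbb{R}^n\to\mathbb{R}$ are locally Lipschitz and upper-$\mathcal C^2$ at every point of $\mathbb{R}^n$; $\phi:\mathbb{R}^n\to\mathbb{R}$ is convex; and $F$ is bounded below on $\Gamma$. Here $h$ is upper-$\mathcal C^2$ at $\bar x$ if there are $\rho\ge 0$, $\delta>0$, a compact $\Delta\subset\mathbb{R}^p$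 and continuous $b:\Delta\to\mathbb{R}^n$, $c:\Delta\to\mathbb{R}$ with $h(x)=\min_{s\in\Delta}\{\frac{\rho}{2}\|x\|^2-\langle b(s),x\rangle-c(s)\}$ whenever $\|x-\bar x\|<\delta$. A point $x\in\Gamma$ is *stationary* for (1) if $0\in\partial g_0(x)+\partial\phi(x)+\bigcup_{\zeta\in\mathcal N_{\mathbb{R}^m_-}(g(x))}\sum_{i=1}^m\zeta_i\,\partial g_i(x)$. For $u=(s,L,V,\xi,\mathcal Q)\in\mathbb U:=\mathbb{R}^n\times\mathbb{R}^m_+\times\mathbb{R}^{n\times m}\times\mathbb{R}^n\times\mathbb S_+$ ($\mathbb S_+$: the positive semidefinite self-adjoint linear maps on $\mathbb{R}^n$), put $\theta(u,x):=g_0(s)+\langle\xi,x-s\rangle+\frac12\langle x-s,\mathcal Q(x-s)\rangle$, $H(u,x):=g(s)+V^\top(x-s)+\frac12\|x-s\|^2L$ and $\mathcal S(u):=\{x: H(u,x)\in\mathbb{R}^m_-\}$. The subproblem with parameter $u$ is $\min\{\theta(u,x)+\phi(x): x\in\mathcal S(u)\}$. **Algorithm.** Given constants $0<\mu_{\min}\le\mu_{\max}$,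 $0<L_{\min}\le L_{\max}$, $M,\beta_C,\beta_S,\alpha>0$, $\tau>1$ and $x^0\in\Gamma$, for $k=0,1,2,\dots$ choose $\xi^k\in\partial g_0(x^k)$, $V^k\in\mathbb{R}^{n\times m}$ with columns $V^k_i\in\partial g_i(x^k)$, $\mu_{k,0}\in[\mu_{\min},\mu_{\max}]$ and $L^{k,0}\in[L_{\min},L_{\max}]^m$. For $j=0,1,2,\dots$ choose a self-adjoint $\mathcal Q_{k,j}$ with $\mu_{k,j}\mathcal I\preceq\mathcal Q_{k,j}\preceq(\mu_{k,j}+M)\mathcal I$, put $u^{k,j}:=(x^k,L^{k,j},V^k,\xi^k,\mathcal Q_{k,j})$, and find $y=y^{k,j}$, $v=v^{k,j}\in\partial\phi(y)$, $\lambda=\lambda^{k,j}\in\mathbb{R}^m_+$ such that $$\theta(u^{k,j},y)+\phi(y)\le\theta(u^{k,j},x^k)+\phi(x^k),$$ $$\big(-\langle\lambda,H(u^{k,j},y)\rangle\big)_++\big\|[H(u^{k,j},y)]_+\big\|_\infty\le\tfrac{\beta_C}{2}\|y-x^k\|^2,$$ $$\big\|\nabla_x\theta(u^{k,j},y)+v+\nabla_xH(u^{k,j},y)\lambda\big\|\le\beta_S\|y-x^k\|.$$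 If $g(y)\in\mathbb{R}^m_-$ and $F(y)\le F(x^k)-\frac{\alpha}{2}\|y-x^k\|^2$, set $j_k:=j$, $x^{k+1}:=y$ and pass to $k+1$. Otherwise continue with $j+1$, where $(L^{k,j+1},\mu_{k,j+1}):=(\tau L^{k,j},\mu_{k,j})$ if $g(y)\notin\mathbb{R}^m_-$ and $(L^{k,j+1},\mu_{k,j+1}):=(L^{k,j},\tau\mu_{k,j})$ if $g(y)\in\mathbb{R}^m_-$. Let $\{x^k\}_{k\in\mathbb N}$ be an infinite sequence so generated, let $\bar x^{k,j}$ be the unique optimal solution of the subproblem with parameter $u^{k,j}$, and write $u^k:=u^{k,j_k}$, $\bar x^k:=\bar x^{k,j_k}$. **Theorem.** Assume: * (Assumption 2) for all $k$ and all $j\le j_k$, the multifunction $x\mapsto H(u^{k,j},x)-\mathbb{R}^m_-$ is metrically subregular at $(\bar x^{k,j},0)$; * (Assumption 3) $\{x^k\}$ is bounded; $\omega(x^0)$ denotes its set of cluster points; * (Assumption 4) at every cluster point $(u^*,x^*)$ of $\{(u^k,\bar x^k)\}$ the partial bounded multiplier property holds: there are $\kappa>0$ and neighbourhoods $\mathcal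 U$ of $u^*$ in $\mathbb U$ and $\mathcal V$ of $x^*$ in $\mathbb{R}^n$ such that for all $u\in\mathcal U$, $x\in\mathcal V\cap\mathcal S(u)$ and $y\in\mathcal N_{\mathcal S(u)}(x)$ there is $\lambda\in\mathcal N_{\mathbb{R}^m_-}(H(u,x))$ with $\nabla_xH(u,x)\lambda=y$ and $\|\lambda\|\le\kappa\|y\|$. Then every point of $\omega(x^0)$ is a stationary point of (1). Moreover, $F(x^k)$ converges to some $\varpi^*\in\mathbb{R}$ as $k\to\infty$, and $F(x)=\varpi^*$ for all $x\in\omega(x^0)$. -/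

import Mathlib

open Filter Topology

noncomputable section

namespace MBA

/-- `ℝⁿ` with the Euclidean norm. -/
abbrev Vec (n : ℕ) := EuclideanSpace ℝ (Fin n)

/-! ### Variational analysis -/

/-- The regular (Fréchet) subdifferential of an extended real valued function `h` at `x ∈ dom h`
(empty if `h x` is not finite). -/
def regularSubdiff {n : ℕ} (h : Vec n → EReal) (x : Vec n) : Set (Vec n) :=
  {v | h x ≠ ⊤ ∧ h x ≠ ⊥ ∧
    0 ≤ liminf (fun x' : Vec n =>
      (h x' - h x - ((inner ℝ v (x' - x) : ℝ) : EReal)) / ((‖x' - x‖ : ℝ) : EReal)) (𝓝[≠] x)}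

/-- The basic (limiting, Mordukhovich) subdifferential of `h` at `x ∈ dom h`. -/
def limitingSubdiff {n : ℕ} (h : Vec n → EReal) (x : Vec n) : Set (Vec n) :=
  {v | h x ≠ ⊤ ∧ h x ≠ ⊥ ∧ ∃ (z w : ℕ → Vec n),
    Tendsto z atTop (𝓝 x) ∧ Tendsto (fun k => h (z k)) atTop (𝓝 (h x)) ∧
    (∀ k, w k ∈ regularSubdiff h (z k)) ∧ Tendsto w atTop (𝓝 v)}

/-- The limiting subdifferential of a real valued function. -/
def limitingSubdiffReal {n : ℕ} (h : Vec n → ℝ) (x : Vec n) : Set (Vec n) :=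
  limitingSubdiff (fun z => (h z : EReal)) x

/-- `h` is finite and Lipschitz continuous on a neighbourhood of `x`. -/
def LipschitzNear {n : ℕ} (h : Vec n → EReal) (x : Vec n) : Prop :=
  ∃ K : NNReal, ∃ U ∈ 𝓝 x, (∀ z ∈ U, h z ≠ ⊤ ∧ h z ≠ ⊥) ∧
    LipschitzOnWith K (fun z => (h z).toReal) U

/-- `h` is upper-`C²` at `x`: near `x` it is a minimum, over a compact parameter set, of quadratic
functions with a common curvature and continuously parametrized coefficients. -/
def UpperC2At {n : ℕ} (h : Vec n → EReal) (x : Vec n) : Prop :=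
  ∃ (ρ δ : ℝ) (p : ℕ) (Δ : Set (Vec p)) (b : Vec p → Vec n) (c : Vec p → ℝ),
    0 ≤ ρ ∧ 0 < δ ∧ IsCompact Δ ∧ ContinuousOn b Δ ∧ ContinuousOn c Δ ∧
    ∀ z ∈ Metric.ball x δ, ∃ r : ℝ, h z = (r : EReal) ∧
      IsLeast ((fun s => ρ / 2 * ‖z‖ ^ 2 - inner ℝ (b s) z - c s) '' Δ) r

/-- The normal cone to a convex set `C` at `x` (empty if `x ∉ C`). -/
def normalCone {n : ℕ} (C : Set (Vec n)) (x : Vec n) : Set (Vec n) :=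
  {v | x ∈ C ∧ ∀ z ∈ C, inner ℝ v (z - x) ≤ 0}

/-- The non-positive orthant. -/
def nonposOrthant (m : ℕ) : Set (Vec m) := {w | ∀ i, w i ≤ 0}

/-- (Metric) subregularity of a multifunction at a point `(xbar, ybar)` of its graph; distances to
the empty set are infinite. -/
def Subregular {n m : ℕ} (T : Vec n → Set (Vec m)) (xbar : Vec n) (ybar : Vec m) : Prop :=
  ybar ∈ T xbar ∧ ∃ δ κ : ℝ, 0 < δ ∧ 0 < κ ∧ ∀ x ∈ Metric.closedBall xbar δ,
    Metric.infEDist x {z | ybar ∈ T z} ≤ ENNReal.ofReal κ * Metric.infEDist ybar (T x)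

/-- The set of cluster points of a sequence. -/
def clusterSet {X : Type*} [TopologicalSpace X] (s : ℕ → X) : Set X :=
  {a | MapClusterPt a atTop s}

/-! ### The optimization problem -/

/-- Data of the problem of minimizing `g₀ x + φ x` subject to `g x ≤ 0`. -/
structure Problem (n m : ℕ) where
  g0 : Vec n → EReal
  g : Vec n → Vec m
  φ : Vec n → ℝ

namespace Problem

variable {n m : ℕ} (P : Problem n m)

/-- The feasible set `Γ`. -/
def feasible : Set (Vec n) := {x | P.g x ∈ nonposOrthant m}

open Classical in
/-- The extended real valued objective `F = g₀ + δ_{ℝ₋ᵐ} ∘ g + φ`. -/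
def F (x : Vec n) : EReal :=
  P.g0 x + (if P.g x ∈ nonposOrthant m then 0 else ⊤) + (P.φ x : EReal)

/-- The limiting subdifferential of `g₀`. -/
def subdiff0 (x : Vec n) : Set (Vec n) := limitingSubdiff P.g0 x

/-- The limiting subdifferential of the constraint function `gᵢ`. -/
def subdiffg (i : Fin m) (x : Vec n) : Set (Vec n) := limitingSubdiffReal (fun z => P.g z i) x

/-- The subdifferential of `φ`. -/
def subdiffφ (x : Vec n) : Set (Vec n) := limitingSubdiffReal P.φ x

/-- The standing assumptions on the problem. -/
structure Standing : Prop where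
  g0_ne_bot : ∀ x, P.g0 x ≠ ⊥
  feasible_nonempty : P.feasible.Nonempty
  g0_upperC2 : ∃ O : Set (Vec n), IsOpen O ∧ Convex ℝ O ∧ P.feasible ⊆ O ∧
    ∀ x ∈ O, LipschitzNear P.g0 x ∧ UpperC2At P.g0 x
  g_upperC2 : ∀ (i : Fin m) (x : Vec n),
    LipschitzNear (fun z => (P.g z i : EReal)) x ∧ UpperC2At (fun z => (P.g z i : EReal)) x
  φ_convex : ConvexOn ℝ Set.univ P.φ
  F_bddBelow : ∃ c : ℝ, ∀ x ∈ P.feasible, (c : EReal) ≤ P.F x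

/-- Stationary points:
`x ∈ Γ` and `0 ∈ ∂g₀(x) + ∂φ(x) + ⋃_{ζ ∈ N_{ℝ₋ᵐ}(g(x))} ∑ᵢ ζᵢ ∂gᵢ(x)`. -/
def Stationary (x : Vec n) : Prop :=
  x ∈ P.feasible ∧ ∃ ξ ∈ P.subdiff0 x, ∃ v ∈ P.subdiffφ x,
    ∃ ζ ∈ normalCone (nonposOrthant m) (P.g x), ∃ w : Fin m → Vec n,
      (∀ i, w i ∈ P.subdiffg i x) ∧ ξ + v + ∑ i, ζ i • w i = 0

/-! ### Subproblems -/

/-- `G(x, s, V, L) = g(s) + Vᵀ(x - s) + ½‖x - s‖² L`; an `n × m` matrix `V` is given by its columns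
`V i`. -/
def G (x s : Vec n) (V : Fin m → Vec n) (L : Vec m) : Vec m :=
  WithLp.toLp 2 fun i => P.g s i + inner ℝ (V i) (x - s) + 1 / 2 * ‖x - s‖ ^ 2 * L i

end Problem

variable {n m : ℕ}

/-- `∇ₓG(x, s, V, L) lam`, the transposed Jacobian of `G(·, s, V, L)` at `x` applied to `lam`. -/
def gradG (x s : Vec n) (V : Fin m → Vec n) (L : Vec m) (lam : Vec m) : Vec n :=
  ∑ i, lam i • (V i + L i • (x - s))

theorem hasGradientAt_inner_G (P : Problem n m) (x s : Vec n) (V : Fin m → Vec n) (L lam : Vec m) :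
    HasGradientAt (fun z => inner ℝ lam (P.G z s V L)) (gradG x s V L lam) x := by
  have key : ∀ i, HasFDerivAt
      (fun z => lam i * (P.g s i + inner ℝ (V i) (z - s) + 1 / 2 * ‖z - s‖ ^ 2 * L i))
      (InnerProductSpace.toDual ℝ (Vec n) (lam i • (V i + L i • (x - s)))) x := by
    intro i
    have h1 : HasFDerivAt (fun z : Vec n => z - s) (ContinuousLinearMap.id ℝ (Vec n)) x :=
      (hasFDerivAt_id x).sub_const s
    have h2 := ((innerSL ℝ (V i)).hasFDerivAt (x := x - s)).comp x h1
    have h3 := (h1.norm_sq.const_mul (1 / 2 : ℝ)).mul_const (L i)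
    have h4 := ((h2.const_add (P.g s i)).add h3).const_mul (lam i)
    refine h4.congr_fderiv ?_
    ext w
    simp
  have hs := HasFDerivAt.fun_sum (u := Finset.univ) (fun i _ => key i)
  rw [HasGradientAt]
  refine (hs.congr_fderiv ?_).congr_of_eventuallyEq (Eventually.of_forall fun z => ?_)
  · simp [gradG, map_sum]
  · simp [Problem.G, PiLp.inner_apply, mul_comm]

/-- The parameters `u = (s, L, V, ξ, Q)` of a subproblem. -/
abbrev Param (n m : ℕ) := Vec n × Vec m × (Fin m → Vec n) × Vec n × (Vec n →L[ℝ] Vec n)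

/-- The parameter set `𝕌`: `L ≥ 0` componentwise and `Q` self-adjoint positive semidefinite. -/
def paramSet (n m : ℕ) : Set (Param n m) := {u | (∀ i, 0 ≤ u.2.1 i) ∧ u.2.2.2.2.IsPositive}

namespace Problem

variable (P : Problem n m)

/-- `θ(u, x) = g₀(s) + ⟨ξ, x - s⟩ + ½⟨x - s, Q(x - s)⟩` (used only with `s ∈ Γ`, where `g₀(s)` is
finite). -/
def theta (u : Param n m) (x : Vec n) : ℝ :=
  match u with
  | (s, _, _, ξ, Q) =>
    (P.g0 s).toReal + inner ℝ ξ (x - s) + 1 / 2 * inner ℝ (x - s) (Q (x - s))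

/-- The constraint mapping `H(u, x) = G(x, s, V, L)`. -/
def H (u : Param n m) (x : Vec n) : Vec m :=
  match u with
  | (s, L, V, _, _) => P.G x s V L

end Problem

/-- `∇ₓθ(u, x) = ξ + Q(x - s)`. -/
def gradTheta (u : Param n m) (x : Vec n) : Vec n :=
  match u with
  | (s, _, _, ξ, Q) => ξ + Q (x - s)

theorem hasGradientAt_theta (P : Problem n m) (u : Param n m) (hu : u.2.2.2.2.IsPositive)
    (x : Vec n) : HasGradientAt (P.theta u) (gradTheta u x) x := by
  obtain ⟨s, L, V, ξ, Q⟩ := u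
  have h1 : HasFDerivAt (fun z : Vec n => z - s) (ContinuousLinearMap.id ℝ (Vec n)) x :=
    (hasFDerivAt_id x).sub_const s
  have h2 := ((innerSL ℝ ξ).hasFDerivAt (x := x - s)).comp x h1
  have h3 := (h1.inner ℝ ((Q.hasFDerivAt (x := x - s)).comp x h1)).const_mul (1 / 2 : ℝ)
  have h4 := (h2.const_add (P.g0 s).toReal).add h3
  rw [HasGradientAt]
  refine h4.congr_fderiv ?_
  ext w
  have hsym : inner ℝ (Q (x - s)) w = inner ℝ (x - s) (Q w) := hu.isSymmetric (x - s) w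
  have hsym' : inner ℝ w (Q (x - s)) = inner ℝ (Q (x - s)) w := real_inner_comm _ _
  simp only [map_sub] at hsym hsym'
  simp [gradTheta, hsym, hsym']
  linarith [hsym, inner_sub_left (𝕜 := ℝ) (Q x) (Q s) w]

/-- `∇ₓH(u, x) lam`. -/
def gradH (u : Param n m) (x : Vec n) (lam : Vec m) : Vec n :=
  match u with
  | (s, L, V, _, _) => gradG x s V L lam

namespace Problem

variable (P : Problem n m)

/-- `𝒮(u) = {x | H(u, x) ∈ ℝ₋ᵐ}`, a convex set for `u ∈ 𝕌`. -/
def solSet (u : Param n m) : Set (Vec n) := {x | P.H u x ∈ nonposOrthant m}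

/-- Objective `θ(u, ·) + φ` of the subproblem with parameter `u`. -/
def subObj (u : Param n m) (x : Vec n) : ℝ := P.theta u x + P.φ x

/-- `x` is an optimal solution of the subproblem: minimize `θ(u, ·) + φ` over `𝒮(u)`. -/
def IsSubSol (u : Param n m) (x : Vec n) : Prop :=
  x ∈ P.solSet u ∧ ∀ z ∈ P.solSet u, P.subObj u x ≤ P.subObj u z

/-- Stationarity residual of the subproblem. -/
def resS (u : Param n m) (x v : Vec n) (lam : Vec m) : ℝ :=
  ‖gradTheta u x + v + gradH u x lam‖

/-- Complementarity and feasibility violation of the subproblem; the norm is the sup norm on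
`Fin m → ℝ`. -/
def resC (u : Param n m) (x : Vec n) (lam : Vec m) : ℝ :=
  max (-inner ℝ lam (P.H u x)) 0 + ‖(fun i => max (P.H u x i) 0 : Fin m → ℝ)‖

/-- The multifunction `H(u, ·) - ℝ₋ᵐ`. -/
def constraintMap (u : Param n m) (x : Vec n) : Set (Vec m) :=
  {w | ∃ q ∈ nonposOrthant m, w = P.H u x - q}

/-- `Λ(u, x, y) = {lam ∈ N_{ℝ₋ᵐ}(H(u, x)) | ∇ₓH(u, x) lam = y}`. -/
def Lam (u : Param n m) (x y : Vec n) : Set (Vec m) :=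
  {lam | lam ∈ normalCone (nonposOrthant m) (P.H u x) ∧ gradH u x lam = y}

/-- The partial bounded multiplier property with respect to `x` of the system `H(u, x) ∈ ℝ₋ᵐ`,
`u ∈ 𝕌`, at `(us, xs)`. -/
def PartialBMP (us : Param n m) (xs : Vec n) : Prop :=
  ∃ κ : ℝ, 0 < κ ∧ ∃ U ∈ 𝓝 us, ∃ W ∈ 𝓝 xs,
    ∀ u ∈ U ∩ paramSet n m, ∀ x ∈ W ∩ P.solSet u, ∀ y ∈ normalCone (P.solSet u) x,
      ∃ lam ∈ P.Lam u x y, ‖lam‖ ≤ κ * ‖y‖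

end Problem

/-! ### The inexact moving balls approximation method -/

/-- Input constants of the algorithm. -/
structure Constants where
  (μmin μmax Lmin Lmax M βC βS α τ : ℝ)
  μmin_pos : 0 < μmin
  μmin_le : μmin ≤ μmax
  Lmin_pos : 0 < Lmin
  Lmin_le : Lmin ≤ Lmax
  M_pos : 0 < M
  βC_pos : 0 < βC
  βS_pos : 0 < βS
  α_pos : 0 < α
  one_lt_τ : 1 < τ

/-- The quantities produced by the algorithm. The inner iterates with indices `k, j` are meaningful
for `j ≤ jacc k`, where `jacc k` is the inner iteration at which the `k`th inner loop stops. -/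
structure Trace (n m : ℕ) where
  x : ℕ → Vec n
  ξ : ℕ → Vec n
  V : ℕ → Fin m → Vec n
  jacc : ℕ → ℕ
  μ : ℕ → ℕ → ℝ
  L : ℕ → ℕ → Vec m
  Q : ℕ → ℕ → Vec n →L[ℝ] Vec n
  y : ℕ → ℕ → Vec n
  v : ℕ → ℕ → Vec n
  lam : ℕ → ℕ → Vec m

namespace Trace

variable (T : Trace n m)

/-- The parameter `(xᵏ, Lᵏʲ, Vᵏ, ξᵏ, Qₖⱼ)` of the subproblem solved at the inner iteration `j` of
the outer iteration `k`. -/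
def paramInner (k j : ℕ) : Param n m := (T.x k, T.L k j, T.V k, T.ξ k, T.Q k j)

/-- The parameter `uᵏ = (xᵏ, Lᵏ, Vᵏ, ξᵏ, Qₖ)` of the accepted subproblem. -/
def param (k : ℕ) : Param n m := T.paramInner k (T.jacc k)

/-- The acceptance test of the inner loop. -/
def Accept (P : Problem n m) (c : Constants) (k j : ℕ) : Prop :=
  P.g (T.y k j) ∈ nonposOrthant m ∧
    P.F (T.y k j) ≤ P.F (T.x k) - ((c.α / 2 * ‖T.y k j - T.x k‖ ^ 2 : ℝ) : EReal)

/-- `T` is an (infinite) execution of the inexact moving balls approximation method. -/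
structure IsRun (P : Problem n m) (c : Constants) : Prop where
  x_zero : T.x 0 ∈ P.feasible
  -- step 1
  ξ_mem : ∀ k, T.ξ k ∈ P.subdiff0 (T.x k)
  V_mem : ∀ k i, T.V k i ∈ P.subdiffg i (T.x k)
  μ_zero : ∀ k, T.μ k 0 ∈ Set.Icc c.μmin c.μmax
  L_zero : ∀ k i, T.L k 0 i ∈ Set.Icc c.Lmin c.Lmax
  -- step 2a: `μ I ⪯ Q ⪯ (μ + M) I` and the inexactness criterion
  Q_lower : ∀ k, ∀ j ≤ T.jacc k,
    (T.Q k j - T.μ k j • ContinuousLinearMap.id ℝ (Vec n)).IsPositive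
  Q_upper : ∀ k, ∀ j ≤ T.jacc k,
    ((T.μ k j + c.M) • ContinuousLinearMap.id ℝ (Vec n) - T.Q k j).IsPositive
  v_mem : ∀ k, ∀ j ≤ T.jacc k, T.v k j ∈ P.subdiffφ (T.y k j)
  lam_nonneg : ∀ k, ∀ j ≤ T.jacc k, ∀ i, 0 ≤ T.lam k j i
  inexact_obj : ∀ k, ∀ j ≤ T.jacc k,
    P.subObj (T.paramInner k j) (T.y k j) ≤ P.subObj (T.paramInner k j) (T.x k)
  inexact_C : ∀ k, ∀ j ≤ T.jacc k,
    P.resC (T.paramInner k j) (T.y k j) (T.lam k j) ≤ c.βC / 2 * ‖T.y k j - T.x k‖ ^ 2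
  inexact_S : ∀ k, ∀ j ≤ T.jacc k,
    Problem.resS (T.paramInner k j) (T.y k j) (T.v k j) (T.lam k j) ≤ c.βS * ‖T.y k j - T.x k‖
  -- step 2b
  accept : ∀ k, T.Accept P c k (T.jacc k)
  not_accept : ∀ k, ∀ j < T.jacc k, ¬ T.Accept P c k j
  -- step 2c
  update_L : ∀ k, ∀ j < T.jacc k, P.g (T.y k j) ∉ nonposOrthant m →
    T.L k (j + 1) = c.τ • T.L k j ∧ T.μ k (j + 1) = T.μ k j
  -- step 2d
  update_μ : ∀ k, ∀ j < T.jacc k, P.g (T.y k j) ∈ nonposOrthant m →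
    T.L k (j + 1) = T.L k j ∧ T.μ k (j + 1) = c.τ * T.μ k j
  -- step 3
  x_succ : ∀ k, T.x (k + 1) = T.y k (T.jacc k)

/-- For all `k, j` the multifunction `G(·, xᵏ, Vᵏ, Lᵏʲ) - ℝ₋ᵐ` is subregular at `(x̄ᵏʲ, 0)`, where
`x̄ᵏʲ` is the (unique) optimal solution of the subproblem. -/
def SubproblemsSubregular (P : Problem n m) : Prop :=
  ∀ k, ∀ j ≤ T.jacc k, ∀ xbar : Vec n, P.IsSubSol (T.paramInner k j) xbar →
    Subregular (P.constraintMap (T.paramInner k j)) xbar 0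

/-- The partial bounded multiplier property holds at every cluster point of `(uᵏ, x̄ᵏ)`, where `x̄ᵏ`
is the (unique) optimal solution of the subproblem with parameter `uᵏ`. -/
def BMPAtClusterPoints (P : Problem n m) : Prop :=
  ∀ xbar : ℕ → Vec n, (∀ k, P.IsSubSol (T.param k) (xbar k)) →
    ∀ w ∈ clusterSet (fun k => (T.param k, xbar k)), P.PartialBMP w.1 w.2

end Trace

end MBA

end

namespace MBA

/-! An upper-`C²` function lies below each of its first-order expansions up to `ρ/2 ‖y - z‖²`, and
on a compact set one `ρ` serves all base points (`exists_uniform_descent`). Hence the inner loop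
stops raising `μ` and `L` at fixed thresholds: a large `L` makes the trial point feasible, and a
large `μ` makes a feasible trial point pass the decrease test (`IsRun.exists_param_bound`). All
subproblem data are therefore bounded. Acceptance makes the objective decrease by `α/2` times the
squared step, so its values converge and the steps tend to zero.

The partial bounded multiplier property speaks of points of `𝒮(u)`, which the inexact iterates need
not be. It is applied to the exact solutions `x̄ᵏ`, whose optimality condition is a normal cone
inclusion; near a cluster point of `(uᵏ, x̄ᵏ)` it yields bounded multipliers. Strong convexity then
compares the inexact and the exact KKT systems (`Problem.kkt_error_bound`): since the inexactness is
measured by the step, `xᵏ⁺¹ - x̄ᵏ` tends to zero along the subsequence. So base point and exact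
solution share a limit, and in the limit of the KKT equations the terms in `Q` and `L` vanish, which
leaves stationarity. -/

/-! ### Subgradients of upper-`C²` functions -/

theorem regularSubdiff_eventually {n : ℕ} {h : Vec n → EReal} {x v : Vec n}
    (hv : v ∈ regularSubdiff h x) (hfin : ∀ᶠ z in 𝓝 x, h z ≠ ⊤ ∧ h z ≠ ⊥) {ε : ℝ} (hε : 0 < ε) :
    ∀ᶠ z in 𝓝 x, (h x).toReal + inner ℝ v (z - x) - ε * ‖z - x‖ ≤ (h z).toReal := by
  obtain ⟨h1, h2, h3⟩ := hv
  have h4 : ((-ε : ℝ) : EReal) < liminf (fun x' : Vec n =>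
      (h x' - h x - ((inner ℝ v (x' - x) : ℝ) : EReal)) / ((‖x' - x‖ : ℝ) : EReal)) (𝓝[≠] x) :=
    lt_of_lt_of_le (by exact_mod_cast (by linarith : -ε < 0)) h3
  have h5 := eventually_nhdsWithin_iff.1 (eventually_lt_of_lt_liminf h4)
  filter_upwards [h5, hfin] with z hz hf
  by_cases hzx : z = x
  · simp [hzx]
  have hz := hz hzx
  have hpos : 0 < ‖z - x‖ := norm_pos_iff.2 (sub_ne_zero.2 hzx)
  rw [← EReal.coe_toReal hf.1 hf.2, ← EReal.coe_toReal h1 h2, ← EReal.coe_sub, ← EReal.coe_sub,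
    ← EReal.coe_div, EReal.coe_lt_coe_iff, lt_div_iff₀ hpos] at hz
  linarith

/-- Test at `z + t • w` with `ε = ‖w‖ / 2`: as `t ↓ 0` the left side is `t ‖w‖²`, the right side
about half of it. -/
theorem eq_of_inner_le_quadratic {n : ℕ} {w z : Vec n} {ρ : ℝ}
    (hw : ∀ ε > 0, ∀ᶠ y in 𝓝 z, inner ℝ w (y - z) ≤ ε * ‖y - z‖ + ρ * ‖y - z‖ ^ 2) : w = 0 := by
  by_contra hne
  have hpos : 0 < ‖w‖ := norm_pos_iff.2 hne
  have ht : Tendsto (fun t : ℝ => z + t • w) (𝓝[>] 0) (𝓝 z) := by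
    have : Tendsto (fun t : ℝ => z + t • w) (𝓝 0) (𝓝 (z + (0 : ℝ) • w)) := by
      apply Continuous.tendsto; fun_prop
    simpa using this.mono_left nhdsWithin_le_nhds
  have h1 := ht.eventually (hw (‖w‖ / 2) (by positivity))
  have h2 : ∀ᶠ t : ℝ in 𝓝[>] 0, t * |ρ| < 1 / 2 := by
    have : Tendsto (fun t : ℝ => t * |ρ|) (𝓝 0) (𝓝 (0 * |ρ|)) := by
      apply Continuous.tendsto; fun_prop
    rw [zero_mul] at this
    exact (this.mono_left nhdsWithin_le_nhds).eventually (gt_mem_nhds (by norm_num))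
  obtain ⟨t, ⟨h1, h2⟩, h3⟩ := ((h1.and h2).and self_mem_nhdsWithin).exists
  have h3 : 0 < t := h3
  rw [add_sub_cancel_left, inner_smul_right, real_inner_self_eq_norm_sq, norm_smul,
    Real.norm_of_nonneg h3.le] at h1
  have h4 : ρ * (t * ‖w‖) ^ 2 ≤ |ρ| * (t * ‖w‖) ^ 2 := by gcongr; exact le_abs_self ρ
  have h5 : (t * |ρ|) * (t * ‖w‖ ^ 2) < 1 / 2 * (t * ‖w‖ ^ 2) := by gcongr
  nlinarith

/-- The descent inequality for regular subgradients of a minimum of quadratic functions. -/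
theorem UpperC2At.exists_descent {n : ℕ} {h : Vec n → EReal} {x : Vec n} (hx : UpperC2At h x) :
    ∃ ρ r : ℝ, 0 ≤ ρ ∧ 0 < r ∧ (∀ z ∈ Metric.ball x r, h z ≠ ⊤ ∧ h z ≠ ⊥) ∧
      ∀ z ∈ Metric.ball x r, ∀ v ∈ limitingSubdiff h z, ∀ y ∈ Metric.ball x r,
        (h y).toReal ≤ (h z).toReal + inner ℝ v (y - z) + ρ / 2 * ‖y - z‖ ^ 2 := by
  obtain ⟨ρ, r, p, Δ, b, c, hρ, hr, -, -, -, hmin⟩ := hx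
  have hfin : ∀ z ∈ Metric.ball x r, h z ≠ ⊤ ∧ h z ≠ ⊥ := by
    intro z hz
    obtain ⟨a, ha, -⟩ := hmin z hz
    simp [ha]
  have hreg : ∀ z ∈ Metric.ball x r, ∀ v ∈ regularSubdiff h z, ∀ y ∈ Metric.ball x r,
        (h y).toReal ≤ (h z).toReal + inner ℝ v (y - z) + ρ / 2 * ‖y - z‖ ^ 2 := by
    intro z hz v hv
    obtain ⟨a, ha, ⟨s, hs, hsa⟩, -⟩ := hmin z hz
    have hle : ∀ y ∈ Metric.ball x r,
        (h y).toReal ≤ (h z).toReal + inner ℝ (ρ • z - b s) (y - z) + ρ / 2 * ‖y - z‖ ^ 2 := by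
      intro y hy
      obtain ⟨a', ha', -, hlb⟩ := hmin y hy
      have h1 := hlb ⟨s, hs, rfl⟩
      rw [ha, ha', EReal.toReal_coe, EReal.toReal_coe]
      refine h1.trans (le_of_eq ?_)
      rw [← hsa]
      simp only [← real_inner_self_eq_norm_sq, inner_sub_left, inner_sub_right, inner_smul_left]
      rw [real_inner_comm z y]
      simp
      ring
    have hnb : Metric.ball x r ∈ 𝓝 z := Metric.isOpen_ball.mem_nhds hz
    -- The quadratic active at `z` touches `h` from above and `v` supports `h` from below to first
    -- order, so `v` must be the gradient of that quadratic.
    have hz0 : v - (ρ • z - b s) = 0 := by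
      apply eq_of_inner_le_quadratic (z := z) (ρ := ρ / 2)
      intro ε hε
      filter_upwards [hnb, regularSubdiff_eventually hv (by filter_upwards [hnb] using hfin) hε]
        with y hy hy'
      have := hle y hy
      rw [inner_sub_left]
      linarith
    rw [sub_eq_zero.1 hz0]
    exact hle
  refine ⟨ρ, r, hρ, hr, hfin, ?_⟩
  rintro z hz v ⟨h1, h2, zs, ws, hzs, hhz, hws, hwv⟩ y hy
  have hh : Tendsto (fun k => (h (zs k)).toReal) atTop (𝓝 (h z).toReal) :=
    (EReal.tendsto_toReal h1 h2).comp hhz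
  have hlim : Tendsto (fun k => (h (zs k)).toReal + inner ℝ (ws k) (y - zs k)
      + ρ / 2 * ‖y - zs k‖ ^ 2) atTop
      (𝓝 ((h z).toReal + inner ℝ v (y - z) + ρ / 2 * ‖y - z‖ ^ 2)) :=
    (hh.add (hwv.inner (tendsto_const_nhds.sub hzs))).add
      (((tendsto_const_nhds.sub hzs).norm.pow 2).const_mul _)
  refine ge_of_tendsto hlim ?_
  filter_upwards [hzs.eventually (Metric.isOpen_ball.mem_nhds hz)] with k hk
  exact hreg _ hk _ (hws k) y hy

theorem LipschitzNear.continuousAt {n : ℕ} {h : Vec n → EReal} {x : Vec n}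
    (hx : LipschitzNear h x) : ContinuousAt (fun z => (h z).toReal) x := by
  obtain ⟨K, U, hU, -, hL⟩ := hx
  exact hL.continuousOn.continuousAt hU

/-- Moving a distance `s` against `v` lowers `h` by at least `s ‖v‖ - ρ/2 s²`, while `h` varies by
at most `2` near `x`. -/
theorem exists_local_subgradient_bound {n : ℕ} {h : Vec n → EReal} {x : Vec n}
    (hl : LipschitzNear h x) (hx : UpperC2At h x) :
    ∃ C : ℝ, ∀ᶠ z in 𝓝 x, ∀ v ∈ limitingSubdiff h z, ‖v‖ ≤ C := by
  obtain ⟨ρ, r, hρ, hr, hfin, hd⟩ := hx.exists_descent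
  have hb : ∀ᶠ z in 𝓝 x, |(h z).toReal - (h x).toReal| < 1 :=
    (Metric.tendsto_nhds.1 hl.continuousAt 1 one_pos)
  obtain ⟨r', hr', hb⟩ := Metric.eventually_nhds_iff_ball.1 hb
  set s := min r r' / 2 with hs
  have hspos : 0 < s := by positivity
  refine ⟨2 / s + ρ / 2 * s, ?_⟩
  filter_upwards [Metric.ball_mem_nhds x hspos] with z hz v hv
  have hsr : 2 * s ≤ r := by have := min_le_left r r'; linarith
  have hsr' : 2 * s ≤ r' := by have := min_le_right r r'; linarith
  rcases eq_or_ne v 0 with rfl | hv0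
  · simp; positivity
  have hvp : 0 < ‖v‖ := norm_pos_iff.2 hv0
  set y := z - (s / ‖v‖) • v with hy
  have hyz : y - z = -((s / ‖v‖) • v) := by simp [hy]
  have hn : ‖y - z‖ = s := by
    rw [hyz, norm_neg, norm_smul, Real.norm_of_nonneg (by positivity)]
    field_simp
  have hi : inner ℝ v (y - z) = - (s * ‖v‖) := by
    rw [hyz, inner_neg_right, inner_smul_right, real_inner_self_eq_norm_sq]
    field_simp
  have hyx : dist y x < 2 * s := by
    have h1 := dist_triangle y z x
    rw [dist_eq_norm y z, hn] at h1
    have := Metric.mem_ball.1 hz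
    linarith
  have hzx := Metric.mem_ball.1 hz
  have h1 := hd z (Metric.mem_ball.2 (by linarith)) v hv y (Metric.mem_ball.2 (by linarith))
  have h2 := abs_lt.1 (hb z (Metric.mem_ball.2 (by linarith)))
  have h3 := abs_lt.1 (hb y (Metric.mem_ball.2 (by linarith)))
  rw [hi, hn] at h1
  have h4 : s * ‖v‖ ≤ 2 + ρ / 2 * s ^ 2 := by linarith
  rw [← sub_nonneg]
  have : 2 / s + ρ / 2 * s - ‖v‖ = (2 + ρ / 2 * s ^ 2 - s * ‖v‖) / s := by field_simp
  rw [this]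
  exact div_nonneg (by linarith) hspos.le

theorem exists_subgradient_bound {n : ℕ} {h : Vec n → EReal} {K : Set (Vec n)} (hK : IsCompact K)
    (hh : ∀ x ∈ K, LipschitzNear h x ∧ UpperC2At h x) :
    ∃ C : ℝ, ∀ z ∈ K, ∀ v ∈ limitingSubdiff h z, ‖v‖ ≤ C := by
  refine hK.induction_on (p := fun s => ∃ C : ℝ, ∀ z ∈ s, ∀ v ∈ limitingSubdiff h z, ‖v‖ ≤ C)
    ⟨0, by simp⟩ (fun s t hst ⟨C, hC⟩ => ⟨C, fun z hz => hC z (hst hz)⟩) ?_ ?_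
  · rintro s t ⟨C, hC⟩ ⟨D, hD⟩
    refine ⟨max C D, ?_⟩
    rintro z (hz | hz) v hv
    · exact (hC z hz v hv).trans (le_max_left _ _)
    · exact (hD z hz v hv).trans (le_max_right _ _)
  · intro x hx
    obtain ⟨C, hC⟩ := exists_local_subgradient_bound (hh x hx).1 (hh x hx).2
    exact ⟨_, nhdsWithin_le_nhds hC, C, fun z hz => hz⟩

/-- Compactness is used on `K ×ˢ K`: near the diagonal the local inequality holds, and away from it
`‖y - z‖` is bounded below, so a large `ρ` absorbs the bounded remaining terms. No convexity of `K`
is needed, which matters because `K` will be a bounded part of `Γ`. -/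
theorem exists_uniform_descent {n : ℕ} {h : Vec n → EReal} {K : Set (Vec n)} (hK : IsCompact K)
    (hh : ∀ x ∈ K, LipschitzNear h x ∧ UpperC2At h x) :
    ∃ ρ : ℝ, 0 ≤ ρ ∧ ∀ z ∈ K, ∀ v ∈ limitingSubdiff h z, ∀ y ∈ K,
      (h y).toReal ≤ (h z).toReal + inner ℝ v (y - z) + ρ / 2 * ‖y - z‖ ^ 2 := by
  obtain ⟨C, hC⟩ := exists_subgradient_bound hK hh
  have hcont : ContinuousOn (fun z => (h z).toReal) K :=
    fun x hx => (hh x hx).1.continuousAt.continuousWithinAt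
  obtain ⟨B, hB⟩ := hK.exists_bound_of_continuousOn hcont
  obtain ⟨R, hR⟩ := hK.isBounded.exists_norm_le
  -- The repeated membership lets the induction predicate be proved on full neighbourhoods, which
  -- may leave `K ×ˢ K`.
  have key : ∃ ρ : ℝ, 0 ≤ ρ ∧ ∀ q ∈ K ×ˢ K, q ∈ K ×ˢ K → ∀ v ∈ limitingSubdiff h q.1,
      (h q.2).toReal ≤ (h q.1).toReal + inner ℝ v (q.2 - q.1) + ρ / 2 * ‖q.2 - q.1‖ ^ 2 := by
    refine (hK.prod hK).induction_on (p := fun s => ∃ ρ : ℝ, 0 ≤ ρ ∧ ∀ q ∈ s, q ∈ K ×ˢ K →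
      ∀ v ∈ limitingSubdiff h q.1,
      (h q.2).toReal ≤ (h q.1).toReal + inner ℝ v (q.2 - q.1) + ρ / 2 * ‖q.2 - q.1‖ ^ 2)
      ⟨0, le_rfl, by simp⟩
      (fun s t hst ⟨ρ, h0, hρ⟩ => ⟨ρ, h0, fun q hq => hρ q (hst hq)⟩) ?_ ?_
    · rintro s t ⟨ρ, h0, hρ⟩ ⟨σ, h0', hσ⟩
      refine ⟨max ρ σ, h0.trans (le_max_left _ _), ?_⟩
      rintro q (hq | hq) hqK v hv
      · refine (hρ q hq hqK v hv).trans ?_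
        gcongr
        exact le_max_left _ _
      · refine (hσ q hq hqK v hv).trans ?_
        gcongr
        exact le_max_right _ _
    · rintro ⟨x, y⟩ ⟨hx, hy⟩
      rcases eq_or_ne x y with rfl | hne
      · obtain ⟨ρ, r, h0, hr, -, hd⟩ := (hh x hx).2.exists_descent
        refine ⟨Metric.ball x r ×ˢ Metric.ball x r, nhdsWithin_le_nhds
          (prod_mem_nhds (Metric.ball_mem_nhds x hr) (Metric.ball_mem_nhds x hr)), ρ, h0, ?_⟩
        rintro ⟨z, y⟩ ⟨hz, hy⟩ - v hv
        exact hd z hz v hv y hy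
      · set d := ‖y - x‖ / 2 with hd
        have hdpos : 0 < d := half_pos (norm_pos_iff.2 (sub_ne_zero.2 hne.symm))
        have hnb : ∀ᶠ q : Vec n × Vec n in 𝓝 (x, y), d < ‖q.2 - q.1‖ := by
          have : Continuous fun q : Vec n × Vec n => ‖q.2 - q.1‖ := by fun_prop
          exact (this.tendsto (x, y)).eventually (lt_mem_nhds (by simp only [hd] at *; linarith))
        -- Chosen so that `ρ/2 d²` covers the variation `2|B|` of `h` plus the bound `|C| (2|R|)` on
        -- the linear term.
        refine ⟨_, nhdsWithin_le_nhds hnb, 2 * ((2 * |B| + |C| * (2 * |R|)) / d ^ 2),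
          by positivity, ?_⟩
        rintro ⟨z, y⟩ hq ⟨hz, hy⟩ v hv
        have hq : d < ‖y - z‖ := hq
        have hz : z ∈ K := hz
        have hy : y ∈ K := hy
        have h1 := abs_le.1 ((hB z hz).trans (le_abs_self B))
        have h2 := abs_le.1 ((hB y hy).trans (le_abs_self B))
        have h3 : ‖y - z‖ ≤ 2 * |R| := by
          have := norm_sub_le y z
          have := (hR z hz).trans (le_abs_self R)
          have := (hR y hy).trans (le_abs_self R)
          linarith
        have h4 : -(|C| * (2 * |R|)) ≤ inner ℝ v (y - z) := by
          have h5 := neg_le_of_abs_le (abs_real_inner_le_norm v (y - z))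
          have h6 : ‖v‖ * ‖y - z‖ ≤ |C| * (2 * |R|) := by
            gcongr
            exact (hC z hz v hv).trans (le_abs_self C)
          linarith
        have h5 : 2 * |B| + |C| * (2 * |R|)
            ≤ 2 * ((2 * |B| + |C| * (2 * |R|)) / d ^ 2) / 2 * ‖y - z‖ ^ 2 := by
          have h6 : d ^ 2 ≤ ‖y - z‖ ^ 2 := by gcongr
          have h7 : 2 * ((2 * |B| + |C| * (2 * |R|)) / d ^ 2) / 2 * ‖y - z‖ ^ 2
            = (2 * |B| + |C| * (2 * |R|)) * (‖y - z‖ ^ 2 / d ^ 2) := by ring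
          rw [h7]
          exact le_mul_of_one_le_right (by positivity) ((one_le_div (by positivity)).2 h6)
        simp only
        linarith
  obtain ⟨ρ, h0, hρ⟩ := key
  exact ⟨ρ, h0, fun z hz v hv y hy => hρ (z, y) ⟨hz, hy⟩ ⟨hz, hy⟩ v hv⟩

/-! ### Closed graph of the limiting subdifferential; convex subgradients -/

/-- Carrying the value `h x` as a coordinate turns attentive convergence into ordinary convergence,
so closedness of the graph needs no diagonal argument. -/
theorem mem_limitingSubdiff_iff_closure {n : ℕ} {h : Vec n → EReal} {x v : Vec n} :
    v ∈ limitingSubdiff h x ↔ h x ≠ ⊤ ∧ h x ≠ ⊥ ∧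
      (x, h x, v) ∈ closure {q : Vec n × EReal × Vec n | q.2.1 = h q.1 ∧
        q.2.2 ∈ regularSubdiff h q.1} := by
  refine and_congr_right fun _ => and_congr_right fun _ => ?_
  rw [mem_closure_iff_seq_limit]
  constructor
  · rintro ⟨z, w, hz, hh, hw, hv⟩
    exact ⟨fun k => (z k, h (z k), w k), fun k => ⟨rfl, hw k⟩, hz.prodMk_nhds (hh.prodMk_nhds hv)⟩
  · rintro ⟨q, hq, hlim⟩
    have h1 := hlim.fst_nhds
    have h2 := hlim.snd_nhds.fst_nhds
    have h3 := hlim.snd_nhds.snd_nhds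
    refine ⟨fun k => (q k).1, fun k => (q k).2.2, h1, ?_, fun k => (hq k).2, h3⟩
    exact h2.congr fun k => (hq k).1

/-- The graph of the limiting subdifferential is closed under attentive convergence. -/
theorem mem_limitingSubdiff_of_tendsto {n : ℕ} {h : Vec n → EReal} {x v : Vec n}
    {z w : ℕ → Vec n} (h1 : h x ≠ ⊤) (h2 : h x ≠ ⊥) (hz : Tendsto z atTop (𝓝 x))
    (hh : Tendsto (fun k => h (z k)) atTop (𝓝 (h x))) (hw : ∀ k, w k ∈ limitingSubdiff h (z k))
    (hv : Tendsto w atTop (𝓝 v)) : v ∈ limitingSubdiff h x := by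
  rw [mem_limitingSubdiff_iff_closure]
  refine ⟨h1, h2, isClosed_closure.mem_of_tendsto (hz.prodMk_nhds (hh.prodMk_nhds hv))
    (Eventually.of_forall fun k => (mem_limitingSubdiff_iff_closure.1 (hw k)).2.2)⟩

/-- Convexity along the segment from `z` to `y` turns the local inequality of a regular subgradient
into a global one; continuity of `φ` carries it to limits. -/
theorem mem_limitingSubdiffReal_iff_of_convexOn {n : ℕ} {φ : Vec n → ℝ}
    (hφ : ConvexOn ℝ Set.univ φ) {x v : Vec n} :
    v ∈ limitingSubdiffReal φ x ↔ ∀ y, φ x + inner ℝ v (y - x) ≤ φ y := by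
  have hcont : Continuous φ := hφ.locallyLipschitz.continuous
  constructor
  · have hreg : ∀ z w, w ∈ regularSubdiff (fun z => (φ z : EReal)) z → ∀ y,
        φ z + inner ℝ w (y - z) ≤ φ y := by
      intro z w hw y
      refine le_of_forall_pos_le_add fun ε hε => ?_
      set δ := ε / (‖y - z‖ + 1) with hδ
      have hδ0 : 0 < δ := by positivity
      have hδε : δ * ‖y - z‖ ≤ ε := by
        rw [hδ, div_mul_eq_mul_div, div_le_iff₀ (by positivity)]
        nlinarith [norm_nonneg (y - z)]
      have h1 := regularSubdiff_eventually hw (by simp) hδ0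
      have ht : Tendsto (fun t : ℝ => z + t • (y - z)) (𝓝[>] 0) (𝓝 z) := by
        have : Tendsto (fun t : ℝ => z + t • (y - z)) (𝓝 0) (𝓝 (z + (0 : ℝ) • (y - z))) := by
          apply Continuous.tendsto; fun_prop
        simpa using this.mono_left nhdsWithin_le_nhds
      have h2 : ∀ᶠ t : ℝ in 𝓝[>] 0, t ∈ Set.Ioo (0 : ℝ) 1 := Ioo_mem_nhdsGT one_pos
      obtain ⟨t, h1, ht0, ht1⟩ := ((ht.eventually h1).and h2).exists
      have h3 := hφ.2 (Set.mem_univ z) (Set.mem_univ y) (sub_nonneg.2 ht1.le) ht0.le (by ring)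
      have h4 : (1 - t) • z + t • y = z + t • (y - z) := by
        rw [smul_sub, sub_smul, one_smul]; abel
      rw [h4] at h3
      simp only [EReal.toReal_coe, add_sub_cancel_left, inner_smul_right, norm_smul,
        Real.norm_of_nonneg ht0.le, smul_eq_mul] at h1 h3
      have h5 : t * (inner ℝ w (y - z)) ≤ t * (φ y - φ z + δ * ‖y - z‖) := by nlinarith
      have h6 := le_of_mul_le_mul_left h5 ht0
      linarith
    rintro ⟨-, -, zs, ws, hzs, -, hws, hwv⟩ y
    have hlim : Tendsto (fun k => φ (zs k) + inner ℝ (ws k) (y - zs k)) atTop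
        (𝓝 (φ x + inner ℝ v (y - x))) :=
      ((hcont.tendsto x).comp hzs).add (hwv.inner (tendsto_const_nhds.sub hzs))
    exact le_of_tendsto hlim (Eventually.of_forall fun k => hreg _ _ (hws k) y)
  · intro hv
    refine ⟨EReal.coe_ne_top _, EReal.coe_ne_bot _, fun _ => x, fun _ => v, tendsto_const_nhds,
      tendsto_const_nhds, fun _ => ⟨EReal.coe_ne_top _, EReal.coe_ne_bot _, ?_⟩,
      tendsto_const_nhds⟩
    refine le_liminf_of_le (by isBoundedDefault) (Eventually.of_forall fun y => ?_)
    rw [← EReal.coe_sub, ← EReal.coe_sub, ← EReal.coe_div]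
    have := hv y
    exact_mod_cast div_nonneg (by linarith) (norm_nonneg _)

/-- Fermat's rule for a convex function plus a linear one on a convex set. -/
theorem exists_subgradient_of_min {n : ℕ} {φ : Vec n → ℝ} (hφ : ConvexOn ℝ Set.univ φ)
    {S : Set (Vec n)} (hS : Convex ℝ S) {x a : Vec n} (hx : x ∈ S)
    (hmin : ∀ z ∈ S, φ x ≤ φ z + inner ℝ a (z - x)) :
    ∃ v, (∀ z, φ x + inner ℝ v (z - x) ≤ φ z) ∧ ∀ z ∈ S, 0 ≤ inner ℝ (a + v) (z - x) := by
  have hcont : Continuous φ := hφ.locallyLipschitz.continuous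
  -- The strict epigraph of `φ` is separated from the region over `S` below the affine function `φ x
  -- - ⟨a, · - x⟩`; minimality makes the two disjoint.
  set A : Set (Vec n × ℝ) := {q | φ q.1 < q.2} with hA
  set B : Set (Vec n × ℝ) := {q | q.1 ∈ S ∧ q.2 ≤ φ x - inner ℝ a (q.1 - x)} with hB
  have hAc : Convex ℝ A := by
    have := hφ.convex_strict_epigraph
    simpa [hA] using this
  have hAo : IsOpen A := isOpen_lt (by fun_prop) (by fun_prop)
  have hBc : Convex ℝ B := by
    rintro ⟨z, t⟩ ⟨hz, ht⟩ ⟨z', t'⟩ ⟨hz', ht'⟩ p q hp hq hpq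
    refine ⟨hS hz hz' hp hq hpq, ?_⟩
    simp only [Prod.smul_mk, Prod.mk_add_mk, smul_eq_mul] at *
    have h1 : p • z + q • z' - x = p • (z - x) + q • (z' - x) := by
      rw [smul_sub, smul_sub, sub_add_sub_comm, ← add_smul, hpq, one_smul]
    rw [h1, inner_add_right, inner_smul_right, inner_smul_right]
    have h2 := mul_le_mul_of_nonneg_left ht hp
    have h3 := mul_le_mul_of_nonneg_left ht' hq
    have h4 : φ x = p * φ x + q * φ x := by rw [← add_mul, hpq, one_mul]
    rw [h4]
    linarith
  have hdisj : Disjoint A B := by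
    rw [Set.disjoint_left]
    rintro ⟨z, t⟩ hzA ⟨hz, ht⟩
    have h1 : φ z < t := hzA
    have := hmin z hz
    simp only at ht
    linarith
  obtain ⟨f, u, hfA, hfB⟩ := geometric_hahn_banach_open hAc hAo hBc hdisj
  set η := f (0, 1) with hη
  have hdec : ∀ z t, f (z, t) = f (z, 0) + t * η := by
    intro z t
    have : ((z, t) : Vec n × ℝ) = (z, 0) + t • (0, 1) := by simp
    rw [this, map_add, map_smul, smul_eq_mul]
  have hη0 : η < 0 := by
    have h1 := hfA (x, φ x + 1) (by simp [hA])
    have h2 := hfB (x, φ x) ⟨hx, by simp⟩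
    rw [hdec] at h1 h2
    linarith
  let ℓ : StrongDual ℝ (Vec n) := f.comp (ContinuousLinearMap.inl ℝ (Vec n) ℝ)
  set w := (InnerProductSpace.toDual ℝ (Vec n)).symm ℓ with hw
  have hwf : ∀ z, f (z, 0) = inner ℝ w z := by
    intro z
    rw [hw, InnerProductSpace.toDual_symm_apply]
    rfl
  have hAle : ∀ z, inner ℝ w z + φ z * η ≤ u := by
    intro z
    have hlim : Tendsto (fun t : ℝ => inner ℝ w z + t * η) (𝓝[>] (φ z))
        (𝓝 (inner ℝ w z + φ z * η)) := by
      refine Tendsto.mono_left (Continuous.tendsto ?_ _) nhdsWithin_le_nhds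
      fun_prop
    refine le_of_tendsto hlim ?_
    filter_upwards [self_mem_nhdsWithin] with t ht
    have := hfA (z, t) ht
    rw [hdec, hwf] at this
    exact this.le
  have hBle : ∀ z ∈ S, u ≤ inner ℝ w z + (φ x - inner ℝ a (z - x)) * η := by
    intro z hz
    have := hfB (z, φ x - inner ℝ a (z - x)) ⟨hz, le_rfl⟩
    rwa [hdec, hwf] at this
  have hBx := hBle x hx
  rw [sub_self, inner_zero_right, sub_zero] at hBx
  -- The hyperplane is not vertical (`η < 0`), so it is the graph of an affine function; its slope
  -- is the subgradient.
  refine ⟨(-η)⁻¹ • w, fun z => ?_, fun z hz => ?_⟩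
  · have h1 := (hAle z).trans hBx
    rw [inner_smul_left, inner_sub_right]
    have h2 : (-η)⁻¹ * (inner ℝ w z - inner ℝ w x) ≤ φ z - φ x := by
      rw [inv_mul_le_iff₀ (by linarith)]
      linarith
    simp only [conj_trivial]
    linarith
  · have h1 := (hAle x).trans (hBle z hz)
    rw [inner_add_left, inner_smul_left, inner_sub_right w]
    have h2 : -inner ℝ a (z - x) ≤ (-η)⁻¹ * (inner ℝ w z - inner ℝ w x) := by
      rw [le_inv_mul_iff₀ (by linarith)]
      linarith
    simp only [conj_trivial]
    linarith

theorem exists_bound_convex_subgradient {n : ℕ} {φ : Vec n → ℝ} (hφ : ConvexOn ℝ Set.univ φ)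
    (R : ℝ) : ∃ C : ℝ, ∀ x v, ‖x‖ ≤ R → (∀ y, φ x + inner ℝ v (y - x) ≤ φ y) → ‖v‖ ≤ C := by
  have hcont : Continuous φ := hφ.locallyLipschitz.continuous
  obtain ⟨B, hB⟩ := (isCompact_closedBall (0 : Vec n) (R + 1)).exists_bound_of_continuousOn
    hcont.continuousOn
  refine ⟨2 * |B|, fun x v hx hv => ?_⟩
  rcases eq_or_ne v 0 with rfl | hv0
  · simp
  have hvp : 0 < ‖v‖ := norm_pos_iff.2 hv0
  have h1 := hv (x + ‖v‖⁻¹ • v)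
  rw [add_sub_cancel_left, inner_smul_right, real_inner_self_eq_norm_sq, pow_two, ← mul_assoc,
    inv_mul_cancel₀ hvp.ne', one_mul] at h1
  have h2 : ‖x + ‖v‖⁻¹ • v‖ ≤ R + 1 := by
    refine (norm_add_le _ _).trans ?_
    rw [norm_smul, norm_inv, norm_norm, inv_mul_cancel₀ hvp.ne']
    linarith
  have h3 := abs_le.1 ((hB (x + ‖v‖⁻¹ • v) (by simpa using h2)).trans (le_abs_self B))
  have h4 := abs_le.1 ((hB x (by simp; linarith)).trans (le_abs_self B))
  linarith

/-! ### Convex analysis of a single subproblem -/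

variable {n m : ℕ}

theorem Problem.theta_expand (P : Problem n m) (u : Param n m) (hu : u.2.2.2.2.IsPositive)
    (y z : Vec n) : P.theta u z = P.theta u y + inner ℝ (gradTheta u y) (z - y)
      + 1 / 2 * inner ℝ (z - y) (u.2.2.2.2 (z - y)) := by
  obtain ⟨s, L, V, ξ, Q⟩ := u
  obtain ⟨d, rfl⟩ : ∃ d, z = y + d := ⟨z - y, by abel⟩
  obtain ⟨e, rfl⟩ : ∃ e, y = s + e := ⟨y - s, by abel⟩
  have hsym : inner ℝ (Q d) e = inner ℝ d (Q e) := hu.isSymmetric d e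
  have h1 : s + e + d - s = e + d := by abel
  simp only [Problem.theta, gradTheta, h1, add_sub_cancel_left, map_add, inner_add_left,
    inner_add_right]
  rw [real_inner_comm d (Q e), ← hsym, real_inner_comm e (Q d)]
  ring

theorem Problem.H_expand (P : Problem n m) (u : Param n m) (lam : Vec m) (y z : Vec n) :
    inner ℝ lam (P.H u z) = inner ℝ lam (P.H u y) + inner ℝ (gradH u y lam) (z - y)
      + 1 / 2 * (∑ i, lam i * u.2.1 i) * ‖z - y‖ ^ 2 := by
  obtain ⟨s, L, V, ξ, Q⟩ := u
  obtain ⟨d, rfl⟩ : ∃ d, z = y + d := ⟨z - y, by abel⟩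
  obtain ⟨e, rfl⟩ : ∃ e, y = s + e := ⟨y - s, by abel⟩
  have h1 : s + e + d - s = e + d := by abel
  have hin : ∀ w : Vec m, inner ℝ lam w = ∑ i, lam i * w i := fun w => by
    rw [PiLp.inner_apply]
    exact Finset.sum_congr rfl fun i _ => by simp [mul_comm]
  rw [hin, hin]
  simp only [Problem.H, Problem.G, gradH, gradG, h1, add_sub_cancel_left,
    sum_inner, Finset.mul_sum, Finset.sum_mul, ← Finset.sum_add_distrib]
  refine Finset.sum_congr rfl fun i _ => ?_
  simp only [inner_smul_left, inner_add_left, inner_add_right, ← real_inner_self_eq_norm_sq,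
    conj_trivial]
  rw [real_inner_comm d e]
  ring

theorem mem_normalCone_nonposOrthant {lam w : Vec m} :
    lam ∈ normalCone (nonposOrthant m) w ↔
      w ∈ nonposOrthant m ∧ (∀ i, 0 ≤ lam i) ∧ inner ℝ lam w = 0 := by
  constructor
  · rintro ⟨hw, h⟩
    have hpos : ∀ i, 0 ≤ lam i := by
      intro i
      have h1 := h (w - EuclideanSpace.single i 1) (by
        intro j
        have := hw j
        by_cases hij : j = i
        · subst hij
          simp
          linarith
        · simpa [hij] using this)
      have h2 : w - EuclideanSpace.single i (1 : ℝ) - w = -EuclideanSpace.single i (1 : ℝ) := by abel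
      rw [h2, inner_neg_right, EuclideanSpace.inner_single_right] at h1
      simpa using h1
    refine ⟨hw, hpos, le_antisymm ?_ ?_⟩
    · rw [PiLp.inner_apply]
      refine Finset.sum_nonpos fun i _ => ?_
      have := mul_nonneg (hpos i) (neg_nonneg.2 (hw i))
      simp only [RCLike.inner_apply, conj_trivial]
      linarith
    · have := h 0 (fun i => by simp)
      rw [zero_sub, inner_neg_right] at this
      linarith
  · rintro ⟨hw, hpos, h0⟩
    refine ⟨hw, fun z hz => ?_⟩
    rw [inner_sub_right, h0, sub_zero, PiLp.inner_apply]
    refine Finset.sum_nonpos fun i _ => ?_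
    have := mul_nonneg (hpos i) (neg_nonneg.2 (hz i))
    simp only [RCLike.inner_apply, conj_trivial]
    linarith

theorem inner_nonpos_of_orthant {lam w : Vec m} (hl : ∀ i, 0 ≤ lam i)
    (hw : w ∈ nonposOrthant m) : inner ℝ lam w ≤ 0 := by
  rw [PiLp.inner_apply]
  refine Finset.sum_nonpos fun i _ => ?_
  have := mul_nonneg (hl i) (neg_nonneg.2 (hw i))
  simp only [RCLike.inner_apply, conj_trivial]
  linarith

theorem Problem.H_gradient_ineq (P : Problem n m) {u : Param n m} (hu : ∀ i, 0 ≤ u.2.1 i)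
    {lam : Vec m} (hl : ∀ i, 0 ≤ lam i) (y z : Vec n) :
    inner ℝ lam (P.H u y) + inner ℝ (gradH u y lam) (z - y) ≤ inner ℝ lam (P.H u z) := by
  rw [P.H_expand u lam y z]
  have h1 : 0 ≤ ∑ i, lam i * u.2.1 i := Finset.sum_nonneg fun i _ => mul_nonneg (hl i) (hu i)
  have : 0 ≤ 1 / 2 * (∑ i, lam i * u.2.1 i) * ‖z - y‖ ^ 2 := by positivity
  linarith

/-- Each coordinate of `H u` is convex: take `lam` a basis vector in the gradient inequality at the
convex combination. -/
theorem Problem.convex_solSet (P : Problem n m) {u : Param n m} (hu : ∀ i, 0 ≤ u.2.1 i) :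
    Convex ℝ (P.solSet u) := by
  intro z hz z' hz' p q hp hq hpq i
  set lam : Vec m := EuclideanSpace.single i 1
  have hl : ∀ j, 0 ≤ lam j := fun j => by
    by_cases hij : j = i <;> simp [lam, hij]
  have hin : ∀ x, inner ℝ lam (P.H u x) = P.H u x i := fun x => by
    simp [lam, EuclideanSpace.inner_single_left]
  set y := p • z + q • z' with hy
  have h1 := P.H_gradient_ineq hu hl y z
  have h2 := P.H_gradient_ineq hu hl y z'
  rw [hin, hin] at h1 h2
  have h3 := mul_le_mul_of_nonneg_left h1 hp
  have h4 := mul_le_mul_of_nonneg_left h2 hq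
  have h5 : p * inner ℝ (gradH u y lam) (z - y) + q * inner ℝ (gradH u y lam) (z' - y) = 0 := by
    rw [← inner_smul_right, ← inner_smul_right, ← inner_add_right]
    have : p • (z - y) + q • (z' - y) = 0 := by
      rw [smul_sub, smul_sub, sub_add_sub_comm, ← add_smul, hpq, one_smul, hy, sub_self]
    rw [this, inner_zero_right]
  have h6 := mul_nonneg hp (neg_nonneg.2 (hz i))
  have h7 := mul_nonneg hq (neg_nonneg.2 (hz' i))
  have h8 : P.H u y i = p * P.H u y i + q * P.H u y i := by rw [← add_mul, hpq, one_mul]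
  rw [h8]
  linarith

theorem Problem.continuous_H (P : Problem n m) (u : Param n m) : Continuous (P.H u) := by
  obtain ⟨s, L, V, ξ, Q⟩ := u
  unfold Problem.H Problem.G
  fun_prop

theorem Problem.continuous_theta (P : Problem n m) (u : Param n m) : Continuous (P.theta u) := by
  obtain ⟨s, L, V, ξ, Q⟩ := u
  unfold Problem.theta
  fun_prop

theorem Problem.subObj_strong (P : Problem n m) {u : Param n m} (hu : u.2.2.2.2.IsPositive)
    {μ : ℝ} (hμ : ∀ w, μ * ‖w‖ ^ 2 ≤ inner ℝ w (u.2.2.2.2 w)) {y v : Vec n}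
    (hv : ∀ z, P.φ y + inner ℝ v (z - y) ≤ P.φ z) (z : Vec n) :
    P.subObj u y + inner ℝ (gradTheta u y + v) (z - y) + μ / 2 * ‖z - y‖ ^ 2 ≤ P.subObj u z := by
  have h1 := hμ (z - y)
  have h2 := hv z
  rw [Problem.subObj, Problem.subObj, P.theta_expand u hu y z, inner_add_left]
  linarith

/-- Optimality is kept as a normal cone inclusion, the form to which the bounded multiplier property
applies. Letting `t ↓ 0` along segments replaces `θ` by its linearization, after which Fermat's rule
for `φ` plus a linear term applies. -/
theorem Problem.IsSubSol.exists_kkt (P : Problem n m) (hφ : ConvexOn ℝ Set.univ P.φ)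
    {u : Param n m} (hu : u ∈ paramSet n m) {x : Vec n} (hx : P.IsSubSol u x) :
    ∃ v, (∀ z, P.φ x + inner ℝ v (z - x) ≤ P.φ z) ∧
      -(gradTheta u x + v) ∈ normalCone (P.solSet u) x := by
  have hS := P.convex_solSet hu.1
  obtain ⟨v, hv, hn⟩ := exists_subgradient_of_min hφ hS (a := gradTheta u x) hx.1 (by
    intro z hz
    set q := inner ℝ (z - x) (u.2.2.2.2 (z - x)) with hq
    have hlim : Tendsto (fun t : ℝ => P.φ z + inner ℝ (gradTheta u x) (z - x) + t * (1 / 2 * q))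
        (𝓝[>] 0) (𝓝 (P.φ z + inner ℝ (gradTheta u x) (z - x))) := by
      have : Tendsto (fun t : ℝ => P.φ z + inner ℝ (gradTheta u x) (z - x) + t * (1 / 2 * q))
        (𝓝 0) (𝓝 (P.φ z + inner ℝ (gradTheta u x) (z - x) + 0 * (1 / 2 * q))) := by
        apply Continuous.tendsto; fun_prop
      rw [zero_mul, add_zero] at this
      exact this.mono_left nhdsWithin_le_nhds
    refine ge_of_tendsto hlim ?_
    filter_upwards [Ioo_mem_nhdsGT (one_pos (α := ℝ))] with t ht
    obtain ⟨ht0, ht1⟩ := ht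
    have h4 : (1 - t) • x + t • z = x + t • (z - x) := by
      rw [smul_sub, sub_smul, one_smul]; abel
    have h1 := hx.2 _ (hS hx.1 hz (sub_nonneg.2 ht1.le) ht0.le (by ring))
    have h2 := hφ.2 (Set.mem_univ x) (Set.mem_univ z) (sub_nonneg.2 ht1.le) ht0.le (by ring)
    rw [h4] at h1 h2
    rw [Problem.subObj, Problem.subObj, P.theta_expand u hu.2 x (x + t • (z - x)),
      add_sub_cancel_left, map_smul, inner_smul_left, inner_smul_right, inner_smul_right, ← hq] at h1
    simp only [smul_eq_mul, conj_trivial] at h1 h2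
    have h5 : t * P.φ x ≤ t * (P.φ z + inner ℝ (gradTheta u x) (z - x) + t * (1 / 2 * q)) := by
      linarith
    exact le_of_mul_le_mul_left h5 ht0)
  refine ⟨v, hv, hx.1, fun z hz => ?_⟩
  rw [inner_neg_left]
  have := hn z hz
  linarith

theorem Problem.exists_isSubSol (P : Problem n m) (hφ : ConvexOn ℝ Set.univ P.φ)
    {u : Param n m} (hu : u ∈ paramSet n m) (hs : (P.solSet u).Nonempty) {μ : ℝ} (hμ0 : 0 < μ)
    (hμ : ∀ w, μ * ‖w‖ ^ 2 ≤ inner ℝ w (u.2.2.2.2 w)) : ∃ x, P.IsSubSol u x := by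
  have hcont : Continuous P.φ := hφ.locallyLipschitz.continuous
  have hcl : IsClosed (P.solSet u) := by
    have : P.solSet u = ⋂ i, {x | P.H u x i ≤ 0} := by
      ext x; simp [Problem.solSet, nonposOrthant]
    rw [this]
    refine isClosed_iInter fun i => isClosed_le ?_ continuous_const
    have := P.continuous_H u
    fun_prop
  obtain ⟨s, hs⟩ := hs
  -- Fermat's rule on the singleton `{s}` merely provides some subgradient of `φ` at `s`.
  obtain ⟨v, hv, -⟩ := exists_subgradient_of_min hφ (convex_singleton s) (a := 0) rfl (by simp)
  have hcoer : Tendsto (P.subObj u) (cocompact (Vec n)) atTop := by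
    have h1 := tendsto_norm_cocompact_atTop (E := Vec n)
    have h2 : Tendsto (fun z : Vec n => ‖z - s‖) (cocompact (Vec n)) atTop := by
      refine tendsto_atTop_mono (fun z => ?_) (tendsto_atTop_add_const_right _ (-‖s‖) h1)
      have := norm_sub_norm_le z s
      linarith
    set a := gradTheta u s + v
    have h3 : Tendsto (fun t : ℝ => P.subObj u s + t * (μ / 2 * t + -‖a‖)) atTop atTop := by
      refine tendsto_atTop_add_const_left _ _ (tendsto_id.atTop_mul_atTop₀ ?_)
      exact tendsto_atTop_add_const_right _ _ (tendsto_id.const_mul_atTop (by positivity))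
    refine tendsto_atTop_mono (fun z => ?_) (h3.comp h2)
    have h4 := P.subObj_strong hu.2 hμ hv z
    have h5 := neg_le_of_abs_le (abs_real_inner_le_norm a (z - s))
    simp only [Function.comp]
    nlinarith
  obtain ⟨x, hx, hmin⟩ := ContinuousOn.exists_isMinOn' (f := P.subObj u)
    (((P.continuous_theta u).add hcont).continuousOn) hcl hs
    ((hcoer.eventually (eventually_ge_atTop (P.subObj u s))).filter_mono inf_le_left)
  exact ⟨x, hx, fun z hz => hmin hz⟩

/-- Distance from an inexact stationary point of the subproblem to a KKT point. -/
theorem Problem.kkt_error_bound (P : Problem n m) {u : Param n m} (hu : u ∈ paramSet n m)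
    {μ : ℝ} (hμ : ∀ w, μ * ‖w‖ ^ 2 ≤ inner ℝ w (u.2.2.2.2 w))
    {x v : Vec n} {lam : Vec m} (hv : ∀ z, P.φ x + inner ℝ v (z - x) ≤ P.φ z)
    (hlam : lam ∈ normalCone (nonposOrthant m) (P.H u x))
    (hkkt : gradTheta u x + v + gradH u x lam = 0)
    {y v' : Vec n} {lam' : Vec m} (hv' : ∀ z, P.φ y + inner ℝ v' (z - y) ≤ P.φ z)
    (hlam' : ∀ i, 0 ≤ lam' i) {A B : ℝ} (hA : P.resC u y lam' ≤ A)
    (hB : Problem.resS u y v' lam' ≤ B) :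
    μ * ‖y - x‖ ^ 2 ≤ (1 + ∑ i, lam i) * A + B * ‖y - x‖ := by
  obtain ⟨hHx, hl, h0⟩ := mem_normalCone_nonposOrthant.1 hlam
  have hmax := norm_nonneg (fun i => max (P.H u y i) 0 : Fin m → ℝ)
  have hHy : ∀ i, P.H u y i ≤ A := fun i => by
    have h1 := norm_le_pi_norm (fun i => max (P.H u y i) 0 : Fin m → ℝ) i
    have h2 : P.H u y i ≤ ‖max (P.H u y i) 0‖ := (le_max_left _ _).trans (le_abs_self _)
    have h3 := le_max_right (-inner ℝ lam' (P.H u y)) 0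
    unfold Problem.resC at hA
    linarith
  have hly : -A ≤ inner ℝ lam' (P.H u y) := by
    have h3 := le_max_left (-inner ℝ lam' (P.H u y)) 0
    unfold Problem.resC at hA
    linarith
  have hly' : inner ℝ lam (P.H u y) ≤ (∑ i, lam i) * A := by
    rw [PiLp.inner_apply, Finset.sum_mul]
    refine Finset.sum_le_sum fun i _ => ?_
    simp only [RCLike.inner_apply, conj_trivial]
    rw [mul_comm]
    exact mul_le_mul_of_nonneg_left (hHy i) (hl i)
  -- Adding the strong convexity inequalities at `x` and `y` cancels the objective values and leaves
  -- `μ ‖y - x‖²`. The gradient terms are replaced, through the two stationarity conditions, by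
  -- constraint terms, bounded by complementarity and infeasibility.
  have h1 := P.subObj_strong hu.2 hμ hv y
  have h2 := P.H_gradient_ineq hu.1 hl x y
  have h3 : inner ℝ (gradTheta u x + v) (y - x) + inner ℝ (gradH u x lam) (y - x) = 0 := by
    rw [← inner_add_left, hkkt, inner_zero_left]
  have h4 := P.subObj_strong hu.2 hμ hv' x
  have h5 := P.H_gradient_ineq hu.1 hlam' y x
  have h6 := inner_nonpos_of_orthant hlam' hHx
  have h7 : -(B * ‖y - x‖) ≤
      inner ℝ (gradTheta u y + v') (x - y) + inner ℝ (gradH u y lam') (x - y) := by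
    rw [← inner_add_left]
    have h8 := neg_le_of_abs_le
      (abs_real_inner_le_norm (gradTheta u y + v' + gradH u y lam') (x - y))
    have h9 : ‖gradTheta u y + v' + gradH u y lam'‖ * ‖x - y‖ ≤ B * ‖y - x‖ := by
      rw [norm_sub_rev x y]
      exact mul_le_mul_of_nonneg_right hB (norm_nonneg _)
    linarith
  rw [norm_sub_rev x y] at h4
  linarith

/-! ### Consequences of the standing assumptions -/

theorem Problem.Standing.continuous_g {P : Problem n m} (hP : P.Standing) : Continuous P.g := by
  refine (PiLp.continuous_toLp 2 _).comp (continuous_pi (f := fun z i => P.g z i) fun i => ?_)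
  refine continuous_iff_continuousAt.2 fun x => ?_
  simpa using (hP.g_upperC2 i x).1.continuousAt

theorem Problem.Standing.isClosed_feasible {P : Problem n m} (hP : P.Standing) :
    IsClosed P.feasible := by
  have : P.feasible = ⋂ i, {x | P.g x i ≤ 0} := by
    ext x; simp [Problem.feasible, nonposOrthant]
  rw [this]
  have := hP.continuous_g
  exact isClosed_iInter fun i => isClosed_le (by fun_prop) continuous_const

theorem Problem.Standing.g0_finite {P : Problem n m} (hP : P.Standing) {x : Vec n}
    (hx : x ∈ P.feasible) : P.g0 x ≠ ⊤ ∧ P.g0 x ≠ ⊥ := by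
  obtain ⟨O, -, -, hO, h⟩ := hP.g0_upperC2
  obtain ⟨K, U, hU, hf, -⟩ := (h x (hO hx)).1
  exact hf x (mem_of_mem_nhds hU)

theorem Problem.Standing.g0_regular {P : Problem n m} (hP : P.Standing) {x : Vec n}
    (hx : x ∈ P.feasible) : LipschitzNear P.g0 x ∧ UpperC2At P.g0 x := by
  obtain ⟨O, -, -, hO, h⟩ := hP.g0_upperC2
  exact h x (hO hx)

theorem Problem.Standing.F_eq {P : Problem n m} (hP : P.Standing) {x : Vec n}
    (hx : x ∈ P.feasible) : P.F x = (((P.g0 x).toReal + P.φ x : ℝ) : EReal) := by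
  have h := hP.g0_finite hx
  have hx' : P.g x ∈ nonposOrthant m := hx
  rw [Problem.F, if_pos hx', add_zero, EReal.coe_add, EReal.coe_toReal h.1 h.2]

theorem Problem.subObj_base (P : Problem n m) (u : Param n m) :
    P.subObj u u.1 = (P.g0 u.1).toReal + P.φ u.1 := by
  obtain ⟨s, L, V, ξ, Q⟩ := u
  simp [Problem.subObj, Problem.theta]

theorem Problem.H_base (P : Problem n m) (u : Param n m) : P.H u u.1 = P.g u.1 := by
  obtain ⟨s, L, V, ξ, Q⟩ := u
  ext i
  simp [Problem.H, Problem.G]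

/-- A self-adjoint operator between `0` and `c I` has norm at most `c`. -/
theorem norm_le_of_isPositive {Q : Vec n →L[ℝ] Vec n} {c : ℝ} (hc : 0 < c) (h0 : Q.IsPositive)
    (h1 : ∀ w, inner ℝ w (Q w) ≤ c * ‖w‖ ^ 2) : ‖Q‖ ≤ c := by
  refine Q.opNorm_le_bound hc.le fun x => ?_
  -- Positivity at this vector gives `c⁻¹ ‖Q x‖² ≤ ⟨x, Q x⟩`, avoiding the spectral theorem.
  have h2 := h0.inner_nonneg_right (x - c⁻¹ • Q x)
  have h3 := h1 (Q x)
  have h4 := h1 x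
  have hsym : inner ℝ (Q x) (Q x) = inner ℝ x (Q (Q x)) := h0.isSymmetric x (Q x)
  simp only [map_sub, map_smul, inner_sub_left, inner_sub_right, inner_smul_left,
    inner_smul_right, conj_trivial, ← hsym, real_inner_self_eq_norm_sq] at h2
  have h5 : c⁻¹ * (c⁻¹ * inner ℝ (Q x) (Q (Q x))) ≤ c⁻¹ * ‖Q x‖ ^ 2 := by
    gcongr
    rwa [inv_mul_le_iff₀ hc]
  have h6 : c⁻¹ * ‖Q x‖ ^ 2 ≤ c * ‖x‖ ^ 2 := by linarith
  rw [inv_mul_le_iff₀ hc] at h6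
  refine le_of_sq_le_sq ?_ (by positivity)
  calc _ ≤ _ := h6
    _ = _ := by ring

/-! ### Bounds along a run, and vanishing steps -/

namespace Trace

variable {P : Problem n m} {c : Constants} {T : Trace n m}

theorem IsRun.feasible (hT : T.IsRun P c) : ∀ k, T.x k ∈ P.feasible
  | 0 => hT.x_zero
  | k + 1 => by rw [hT.x_succ]; exact (hT.accept k).1

theorem IsRun.inner_lower (hT : T.IsRun P c) (k : ℕ) : ∀ j ≤ T.jacc k,
    c.μmin ≤ T.μ k j ∧ ∃ t : ℝ, 1 ≤ t ∧ ∀ i, T.L k j i = t * T.L k 0 i := by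
  intro j
  induction j with
  | zero => exact fun _ => ⟨(hT.μ_zero k).1, 1, le_rfl, by simp⟩
  | succ j ih =>
    intro hj
    obtain ⟨h1, t, ht, hL⟩ := ih (by omega)
    by_cases hg : P.g (T.y k j) ∈ nonposOrthant m
    · obtain ⟨e1, e2⟩ := hT.update_μ k j (by omega) hg
      refine ⟨?_, t, ht, by rwa [e1]⟩
      rw [e2]
      have := c.μmin_pos
      exact h1.trans (le_mul_of_one_le_left (by linarith) c.one_lt_τ.le)
    · obtain ⟨e1, e2⟩ := hT.update_L k j (by omega) hg
      refine ⟨by rwa [e2], c.τ * t, ?_, fun i => ?_⟩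
      · nlinarith [c.one_lt_τ]
      · rw [e1, PiLp.smul_apply, hL, smul_eq_mul, mul_assoc]

theorem IsRun.L_pos (hT : T.IsRun P c) {k j : ℕ} (hj : j ≤ T.jacc k) (i : Fin m) :
    0 < T.L k j i := by
  obtain ⟨-, t, ht, hL⟩ := hT.inner_lower k j hj
  rw [hL]
  have := c.Lmin_pos.trans_le (hT.L_zero k i).1
  positivity

theorem IsRun.Q_inner_lower (hT : T.IsRun P c) {k j : ℕ} (hj : j ≤ T.jacc k) (w : Vec n) :
    T.μ k j * ‖w‖ ^ 2 ≤ inner ℝ w (T.Q k j w) := by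
  have := (hT.Q_lower k j hj).inner_nonneg_right w
  simp only [sub_apply, smul_apply,
    ContinuousLinearMap.id_apply, inner_sub_right, inner_smul_right,
    real_inner_self_eq_norm_sq] at this
  linarith

theorem IsRun.Q_inner_lower_min (hT : T.IsRun P c) {k j : ℕ} (hj : j ≤ T.jacc k) (w : Vec n) :
    c.μmin * ‖w‖ ^ 2 ≤ inner ℝ w (T.Q k j w) :=
  (mul_le_mul_of_nonneg_right (hT.inner_lower k j hj).1 (by positivity)).trans
    (hT.Q_inner_lower hj w)

theorem IsRun.Q_inner_upper (hT : T.IsRun P c) {k j : ℕ} (hj : j ≤ T.jacc k) (w : Vec n) :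
    inner ℝ w (T.Q k j w) ≤ (T.μ k j + c.M) * ‖w‖ ^ 2 := by
  have := (hT.Q_upper k j hj).inner_nonneg_right w
  simp only [sub_apply, smul_apply,
    ContinuousLinearMap.id_apply, inner_sub_right, inner_smul_right,
    real_inner_self_eq_norm_sq] at this
  linarith

theorem IsRun.Q_isPositive (hT : T.IsRun P c) {k j : ℕ} (hj : j ≤ T.jacc k) :
    (T.Q k j).IsPositive := by
  have hμ : 0 ≤ T.μ k j := c.μmin_pos.le.trans (hT.inner_lower k j hj).1
  have h1 := (hT.Q_lower k j hj).add
    ((ContinuousLinearMap.isPositive_one (𝕜 := ℝ) (E := Vec n)).smul_of_nonneg hμ)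
  convert h1 using 1
  exact (sub_add_cancel _ _).symm

theorem IsRun.mem_paramSet (hT : T.IsRun P c) {k j : ℕ} (hj : j ≤ T.jacc k) :
    T.paramInner k j ∈ paramSet n m :=
  ⟨fun i => (hT.L_pos hj i).le, hT.Q_isPositive hj⟩

theorem IsRun.exists_data_bound (hP : P.Standing) (hT : T.IsRun P c)
    (hbdd : Bornology.IsBounded (Set.range T.x)) :
    ∃ R : ℝ, ∀ k, ‖T.x k‖ ≤ R ∧ ‖T.ξ k‖ ≤ R ∧ ∀ i, ‖T.V k i‖ ≤ R := by
  obtain ⟨R, hR⟩ := hbdd.exists_norm_le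
  have hR : ∀ k, ‖T.x k‖ ≤ R := fun k => hR _ ⟨k, rfl⟩
  have hK := isCompact_closedBall (0 : Vec n) R
  obtain ⟨C, hC⟩ := exists_subgradient_bound (hK.inter_left hP.isClosed_feasible)
    (fun x hx => hP.g0_regular hx.1)
  choose D hD using fun i => exists_subgradient_bound hK (fun x _ => hP.g_upperC2 i x)
  refine ⟨|R| + |C| + ∑ i, |D i|, fun k => ?_⟩
  have h0 : 0 ≤ ∑ i, |D i| := Finset.sum_nonneg fun i _ => abs_nonneg _
  have hmem : T.x k ∈ Metric.closedBall (0 : Vec n) R := by simpa using hR k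
  refine ⟨?_, ?_, fun i => ?_⟩
  · linarith [hR k, le_abs_self R, abs_nonneg C]
  · linarith [hC _ ⟨hT.feasible k, hmem⟩ _ (hT.ξ_mem k), le_abs_self C, abs_nonneg R]
  · have := Finset.single_le_sum (fun i _ => abs_nonneg (D i)) (Finset.mem_univ i)
    linarith [hD i _ hmem _ (hT.V_mem k i), le_abs_self (D i), abs_nonneg R, abs_nonneg C]

/-- The modulus `μmin` of strong convexity is common to all subproblems and the subgradients at `xᵏ`
are bounded. The bound serves the inexact iterates and the exact solutions alike. -/
theorem IsRun.exists_step_bound (hP : P.Standing) (hT : T.IsRun P c)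
    (hbdd : Bornology.IsBounded (Set.range T.x)) :
    ∃ D : ℝ, ∀ k, ∀ j ≤ T.jacc k, ∀ z,
      P.subObj (T.paramInner k j) z ≤ P.subObj (T.paramInner k j) (T.x k) → ‖z - T.x k‖ ≤ D := by
  obtain ⟨R, hR⟩ := hT.exists_data_bound hP hbdd
  obtain ⟨C, hC⟩ := exists_bound_convex_subgradient hP.φ_convex R
  refine ⟨2 * (R + C) / c.μmin, fun k j hj z hz => ?_⟩
  obtain ⟨w, hw, -⟩ := exists_subgradient_of_min hP.φ_convex (convex_singleton (T.x k)) (a := 0)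
    rfl (by simp)
  have h1 := P.subObj_strong (u := T.paramInner k j) (hT.Q_isPositive hj)
    (hT.Q_inner_lower_min hj) hw z
  have h2 : gradTheta (T.paramInner k j) (T.x k) = T.ξ k := by simp [gradTheta, paramInner]
  rw [h2] at h1
  have h3 := neg_le_of_abs_le (abs_real_inner_le_norm (T.ξ k + w) (z - T.x k))
  have h4 : ‖T.ξ k + w‖ ≤ R + C :=
    (norm_add_le _ _).trans (add_le_add (hR k).2.1 (hC _ _ (hR k).1 hw))
  have h5 : ‖T.ξ k + w‖ * ‖z - T.x k‖ ≤ (R + C) * ‖z - T.x k‖ := by gcongr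
  rw [le_div_iff₀ c.μmin_pos]
  rcases (norm_nonneg (z - T.x k)).eq_or_lt with h0 | h0
  · rw [← h0]
    linarith [norm_nonneg (T.ξ k + w)]
  · have : ‖z - T.x k‖ * c.μmin * ‖z - T.x k‖ ≤ 2 * (R + C) * ‖z - T.x k‖ := by
      linear_combination 2 * (h1 + hz + h3 + h5)
    exact le_of_mul_le_mul_right this h0

/-- A parameter is multiplied by `τ` only while below its threshold, so it overshoots by at most the
factor `τ`. As `L` is rescaled as a whole, a single scalar `t` tracks it. -/
theorem IsRun.exists_param_bound (hP : P.Standing) (hT : T.IsRun P c)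
    (hbdd : Bornology.IsBounded (Set.range T.x)) :
    ∃ B : ℝ, 0 ≤ B ∧ ∀ k, ∀ j ≤ T.jacc k, T.μ k j ≤ B ∧ ∀ i, T.L k j i ≤ B := by
  obtain ⟨R, hR⟩ := hT.exists_data_bound hP hbdd
  obtain ⟨D, hD⟩ := hT.exists_step_bound hP hbdd
  have hK := isCompact_closedBall (0 : Vec n) (R + D)
  have hD0 : 0 ≤ D := (norm_nonneg _).trans (hD 0 0 (Nat.zero_le _) _ le_rfl)
  have hx : ∀ k, T.x k ∈ Metric.closedBall (0 : Vec n) (R + D) := fun k => by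
    simpa using (hR k).1.trans (by linarith)
  have hy : ∀ k, ∀ j ≤ T.jacc k, T.y k j ∈ Metric.closedBall (0 : Vec n) (R + D) := by
    intro k j hj
    have h1 := hD k j hj _ (hT.inexact_obj k j hj)
    have h2 := norm_add_le (T.x k) (T.y k j - T.x k)
    rw [add_sub_cancel] at h2
    simpa using h2.trans (add_le_add (hR k).1 h1)
  obtain ⟨ρ, hρ0, hρ⟩ := exists_uniform_descent (hK.inter_left hP.isClosed_feasible)
    (fun x hx => hP.g0_regular hx.1)
  choose σ hσ0 hσ using fun i => exists_uniform_descent hK (fun x _ => hP.g_upperC2 i x)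
  set s := ∑ i, σ i with hs
  have hs0 : 0 ≤ s := Finset.sum_nonneg fun i _ => hσ0 i
  have hσs : ∀ i, σ i ≤ s := fun i => Finset.single_le_sum (fun i _ => hσ0 i) (Finset.mem_univ i)
  set b := max 1 (c.τ * ((c.βC + s) / c.Lmin)) with hb
  have hτ := c.one_lt_τ
  have key : ∀ k, ∀ j ≤ T.jacc k, T.μ k j ≤ max c.μmax (c.τ * (ρ + c.α)) ∧
      ∃ t : ℝ, 1 ≤ t ∧ t ≤ b ∧ ∀ i, T.L k j i = t * T.L k 0 i := by
    intro k j
    induction j with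
    | zero => exact fun _ => ⟨(hT.μ_zero k).2.trans (le_max_left _ _), 1, le_rfl, le_max_left _ _,
        by simp⟩
    | succ j ih =>
      intro hj
      have hj' : j ≤ T.jacc k := by omega
      obtain ⟨h1, t, ht, htb, hL⟩ := ih hj'
      have hobj := hT.inexact_obj k j hj'
      set y := T.y k j with hyd
      set d := ‖y - T.x k‖ ^ 2 with hd
      have hd0 : 0 ≤ d := by positivity
      by_cases hg : P.g y ∈ nonposOrthant m
      · obtain ⟨e1, e2⟩ := hT.update_μ k j (by omega) hg
        refine ⟨?_, t, ht, htb, by rwa [e1]⟩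
        rw [e2]
        refine le_trans ?_ (le_max_right _ _)
        refine mul_le_mul_of_nonneg_left ?_ (by linarith)
        -- If `μ > ρ + α`, the quadratic model exceeds the descent bound by `α/2 ‖y - xᵏ‖²`, so the
        -- feasible `y` would have been accepted.
        by_contra! hlt
        refine hT.not_accept k j (by omega) ⟨hg, ?_⟩
        rw [hP.F_eq (hT.feasible k), hP.F_eq (x := T.y k j) hg, ← EReal.coe_sub,
          EReal.coe_le_coe_iff, ← hyd, ← hd]
        have h2 := hρ (T.x k) ⟨hT.feasible k, hx k⟩ _ (hT.ξ_mem k) y ⟨hg, hy k j hj'⟩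
        have h3 := hT.Q_inner_lower hj' (y - T.x k)
        have h4 := P.subObj_base (T.paramInner k j)
        simp only [paramInner] at h4
        simp only [paramInner, Problem.subObj, Problem.theta] at hobj h4
        rw [h4] at hobj
        rw [← hd] at h2 h3
        have h5 : (ρ + c.α) * d ≤ T.μ k j * d := by gcongr
        linarith
      · obtain ⟨e1, e2⟩ := hT.update_L k j (by omega) hg
        refine ⟨by rwa [e2], c.τ * t, by nlinarith, ?_, fun i => ?_⟩
        · refine le_trans ?_ (le_max_right _ _)
          refine mul_le_mul_of_nonneg_left ?_ (by linarith)
          rw [le_div_iff₀ c.Lmin_pos]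
          -- Otherwise every `Lᵢ ≥ σᵢ + βC`, which absorbs both the curvature of `gᵢ` and the
          -- allowed violation `βC/2 ‖y - xᵏ‖²`, so `y` would be feasible.
          by_contra! hlt
          refine hg fun i => ?_
          have h2 := hσ i (T.x k) (hx k) _ (hT.V_mem k i) y (hy k j hj')
          simp only [EReal.toReal_coe] at h2
          have h3 := hT.inexact_C k j hj'
          have h4 := le_max_right (-inner ℝ (T.lam k j) (P.H (T.paramInner k j) y)) 0
          have h5 := norm_le_pi_norm (fun i => max (P.H (T.paramInner k j) y i) 0 : Fin m → ℝ) i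
          have h6 : P.H (T.paramInner k j) y i ≤ ‖max (P.H (T.paramInner k j) y i) 0‖ :=
            (le_max_left _ _).trans (le_abs_self _)
          have h7 : P.H (T.paramInner k j) y i ≤ c.βC / 2 * d := by
            unfold Problem.resC at h3
            linarith
          simp only [paramInner, Problem.H, Problem.G] at h7
          rw [← hd] at h7 h2
          have h8 : σ i + c.βC ≤ T.L k j i := by
            rw [hL]
            have := (hT.L_zero k i).1
            have := hσs i
            have : t * c.Lmin ≤ t * T.L k 0 i := by gcongr
            linarith
          have h9 : (σ i + c.βC) * d ≤ T.L k j i * d := by gcongr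
          linarith
        · rw [e1, PiLp.smul_apply, hL, smul_eq_mul, mul_assoc]
  have hμ0 := c.μmin_pos.le.trans c.μmin_le
  have hL0 := c.Lmin_pos.le.trans c.Lmin_le
  have hb0 : 0 ≤ b := zero_le_one.trans (le_max_left _ _)
  refine ⟨max c.μmax (c.τ * (ρ + c.α)) + b * c.Lmax,
    add_nonneg (hμ0.trans (le_max_left _ _)) (by positivity), fun k j hj => ?_⟩
  obtain ⟨h1, t, ht, htb, hL⟩ := key k j hj
  refine ⟨by nlinarith [mul_nonneg hb0 hL0], fun i => ?_⟩
  rw [hL]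
  have h2 := hT.L_zero k i
  have h3 : t * T.L k 0 i ≤ b * c.Lmax :=
    mul_le_mul htb h2.2 (c.Lmin_pos.le.trans h2.1) hb0
  linarith [hμ0.trans (le_max_left c.μmax (c.τ * (ρ + c.α)))]

theorem IsRun.descent (hP : P.Standing) (hT : T.IsRun P c) (k : ℕ) :
    (P.g0 (T.x (k + 1))).toReal + P.φ (T.x (k + 1)) + c.α / 2 * ‖T.x (k + 1) - T.x k‖ ^ 2
      ≤ (P.g0 (T.x k)).toReal + P.φ (T.x k) := by
  have h := (hT.accept k).2
  rw [← hT.x_succ, hP.F_eq (hT.feasible k), hP.F_eq (hT.feasible (k + 1)), ← EReal.coe_sub,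
    EReal.coe_le_coe_iff] at h
  linarith

theorem IsRun.exists_objective_limit (hP : P.Standing) (hT : T.IsRun P c) :
    ∃ ϖ : ℝ, Tendsto (fun k => (P.g0 (T.x k)).toReal + P.φ (T.x k)) atTop (𝓝 ϖ) := by
  obtain ⟨b, hb⟩ := hP.F_bddBelow
  refine ⟨_, tendsto_atTop_ciInf (antitone_nat_of_succ_le fun k => ?_) ⟨b, ?_⟩⟩
  · have := hT.descent hP k
    have h2 : 0 ≤ c.α / 2 * ‖T.x (k + 1) - T.x k‖ ^ 2 := by have := c.α_pos; positivity
    linarith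
  · rintro _ ⟨k, rfl⟩
    have := hb _ (hT.feasible k)
    rwa [hP.F_eq (hT.feasible k), EReal.coe_le_coe_iff] at this

theorem IsRun.tendsto_step (hP : P.Standing) (hT : T.IsRun P c) :
    Tendsto (fun k => ‖T.x (k + 1) - T.x k‖) atTop (𝓝 0) := by
  obtain ⟨ϖ, hϖ⟩ := hT.exists_objective_limit hP
  have h1 := hϖ.sub (hϖ.comp (tendsto_add_atTop_nat 1))
  have h2 := (h1.const_mul (2 / c.α)).sqrt
  rw [sub_self, mul_zero, Real.sqrt_zero] at h2
  refine squeeze_zero (fun k => norm_nonneg _) (fun k => ?_) h2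
  refine Real.le_sqrt_of_sq_le ?_
  have := hT.descent hP k
  have hα := c.α_pos
  rw [div_mul_eq_mul_div, le_div_iff₀ hα]
  simp only [Function.comp]
  linarith

end Trace

/-! ### Norm estimates and limits of subproblem data -/

theorem norm_le_of_coord_le {w : Vec m} {B : ℝ} (hB : 0 ≤ B) (hw : ∀ i, 0 ≤ w i ∧ w i ≤ B) :
    ‖w‖ ≤ m * B := by
  refine le_of_sq_le_sq ?_ (by positivity)
  rw [EuclideanSpace.real_norm_sq_eq]
  have h1 : ∑ i, w i ^ 2 ≤ ∑ _i : Fin m, B ^ 2 :=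
    Finset.sum_le_sum fun i _ => pow_le_pow_left₀ (hw i).1 (hw i).2 2
  rw [Finset.sum_const, Finset.card_univ, Fintype.card_fin, nsmul_eq_mul] at h1
  have h2 : (m : ℝ) ≤ (m : ℝ) ^ 2 := by exact_mod_cast Nat.le_self_pow two_ne_zero m
  rw [mul_pow]
  exact h1.trans (mul_le_mul_of_nonneg_right h2 (by positivity))

theorem sum_le_card_mul_norm (w : Vec m) : ∑ i, w i ≤ m * ‖w‖ := by
  have : ∑ i, w i ≤ ∑ _i : Fin m, ‖w‖ :=
    Finset.sum_le_sum fun i _ => (le_abs_self _).trans (PiLp.norm_apply_le w i)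
  simpa using this

theorem tendsto_gradTheta {ι : Type*} {l : Filter ι} {u : ι → Param n m} {x : ι → Vec n}
    {us : Param n m} {xs : Vec n} (hu : Tendsto u l (𝓝 us)) (hx : Tendsto x l (𝓝 xs)) :
    Tendsto (fun k => gradTheta (u k) (x k)) l (𝓝 (gradTheta us xs)) := by
  have h : Continuous fun q : Param n m × Vec n => gradTheta q.1 q.2 := by
    change Continuous fun q : Param n m × Vec n => q.1.2.2.2.1 + q.1.2.2.2.2 (q.2 - q.1.1)
    fun_prop
  exact (h.tendsto (us, xs)).comp (hu.prodMk_nhds hx)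

theorem tendsto_gradH {ι : Type*} {l : Filter ι} {u : ι → Param n m} {x : ι → Vec n}
    {w : ι → Vec m} {us : Param n m} {xs : Vec n} {ws : Vec m} (hu : Tendsto u l (𝓝 us))
    (hx : Tendsto x l (𝓝 xs)) (hw : Tendsto w l (𝓝 ws)) :
    Tendsto (fun k => gradH (u k) (x k) (w k)) l (𝓝 (gradH us xs ws)) := by
  have hcoord : ∀ (z : ι → Vec m) (zs : Vec m), Tendsto z l (𝓝 zs) → ∀ i,
      Tendsto (fun k => z k i) l (𝓝 (zs i)) := fun z zs hz i =>
    ((by fun_prop : Continuous fun v : Vec m => v i).tendsto zs).comp hz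
  change Tendsto (fun k => ∑ i, w k i • ((u k).2.2.1 i + (u k).2.1 i • (x k - (u k).1))) l
    (𝓝 (∑ i, ws i • (us.2.2.1 i + us.2.1 i • (xs - us.1))))
  refine tendsto_finsetSum _ fun i _ => ?_
  have hV : Tendsto (fun k => (u k).2.2.1 i) l (𝓝 (us.2.2.1 i)) :=
    tendsto_pi_nhds.1 hu.snd_nhds.snd_nhds.fst_nhds i
  have hL : Tendsto (fun k => (u k).2.1 i) l (𝓝 (us.2.1 i)) := hcoord _ _ hu.snd_nhds.fst_nhds i
  have hw' : Tendsto (fun k => w k i) l (𝓝 (ws i)) := hcoord _ _ hw i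
  exact hw'.smul (hV.add (hL.smul (hx.sub hu.fst_nhds)))

theorem Problem.tendsto_H (P : Problem n m) (hg : Continuous P.g) {ι : Type*} {l : Filter ι}
    {u : ι → Param n m} {x : ι → Vec n} {us : Param n m} {xs : Vec n} (hu : Tendsto u l (𝓝 us))
    (hx : Tendsto x l (𝓝 xs)) : Tendsto (fun k => P.H (u k) (x k)) l (𝓝 (P.H us xs)) := by
  have h : Continuous fun q : Param n m × Vec n => P.H q.1 q.2 := by
    change Continuous fun q : Param n m × Vec n => WithLp.toLp 2 fun i =>
      P.g q.1.1 i + inner ℝ (q.1.2.2.1 i) (q.2 - q.1.1) + 1 / 2 * ‖q.2 - q.1.1‖ ^ 2 * q.1.2.1 i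
    fun_prop
  exact (h.tendsto (us, xs)).comp (hu.prodMk_nhds hx)

theorem mem_normalCone_nonposOrthant_of_tendsto {lam w : ℕ → Vec m} {lams ws : Vec m}
    (h : ∀ k, lam k ∈ normalCone (nonposOrthant m) (w k)) (hl : Tendsto lam atTop (𝓝 lams))
    (hw : Tendsto w atTop (𝓝 ws)) : lams ∈ normalCone (nonposOrthant m) ws := by
  have h := fun k => mem_normalCone_nonposOrthant.1 (h k)
  have hc : ∀ (z : ℕ → Vec m) (zs : Vec m), Tendsto z atTop (𝓝 zs) → ∀ i,
      Tendsto (fun k => z k i) atTop (𝓝 (zs i)) := fun z zs hz i =>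
    ((by fun_prop : Continuous fun v : Vec m => v i).tendsto zs).comp hz
  refine mem_normalCone_nonposOrthant.2 ⟨fun i => ?_, fun i => ?_, ?_⟩
  · exact le_of_tendsto (hc _ _ hw i) (Eventually.of_forall fun k => (h k).1 i)
  · exact ge_of_tendsto (hc _ _ hl i) (Eventually.of_forall fun k => (h k).2.1 i)
  · refine tendsto_nhds_unique (hl.inner hw) ?_
    exact tendsto_const_nhds.congr fun k => ((h k).2.2).symm

/-! ### Exact solutions and stationarity of cluster points -/

namespace Trace

variable {P : Problem n m} {c : Constants} {T : Trace n m}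

/-- Since `H(uᵏ, xᵏ) = g(xᵏ) ≤ 0`, the point `xᵏ` competes in its own subproblem, so the step bound
applies to the exact solution. -/
theorem IsRun.exists_subSol_bound (hP : P.Standing) (hT : T.IsRun P c)
    (hbdd : Bornology.IsBounded (Set.range T.x)) :
    ∃ C : ℝ, ∀ (xbar : ℕ → Vec n), (∀ k, P.IsSubSol (T.param k) (xbar k)) →
      (∀ k, ‖(T.param k, xbar k)‖ ≤ C) ∧ ∀ k, ∀ v : Vec n,
      (∀ z, P.φ (xbar k) + inner ℝ v (z - xbar k) ≤ P.φ z) →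
        ‖v‖ ≤ C ∧ ‖gradTheta (T.param k) (xbar k) + v‖ ≤ C := by
  obtain ⟨R, hR⟩ := hT.exists_data_bound hP hbdd
  obtain ⟨D, hD⟩ := hT.exists_step_bound hP hbdd
  obtain ⟨B, hB0, hB⟩ := hT.exists_param_bound hP hbdd
  obtain ⟨E, hE⟩ := exists_bound_convex_subgradient hP.φ_convex (R + D)
  have hR0 : 0 ≤ R := (norm_nonneg _).trans (hR 0).1
  have hD0 : 0 ≤ D := (norm_nonneg _).trans (hD 0 0 (Nat.zero_le _) _ le_rfl)
  have hM := c.M_pos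
  have hBM : 0 ≤ (B + c.M) * D := by positivity
  have hmB : 0 ≤ (m : ℝ) * B := by positivity
  refine ⟨R + m * B + B + c.M + D + |E| + (B + c.M) * D, fun xbar hx => ?_⟩
  have hE0 := abs_nonneg E
  have hQ : ∀ k, ‖T.Q k (T.jacc k)‖ ≤ B + c.M := fun k => by
    refine norm_le_of_isPositive (by linarith) (hT.Q_isPositive le_rfl) fun w => ?_
    refine (hT.Q_inner_upper le_rfl w).trans ?_
    gcongr
    exact (hB k _ le_rfl).1
  have hd : ∀ k, ‖xbar k - T.x k‖ ≤ D := fun k => by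
    refine hD k _ le_rfl _ ((hx k).2 _ ?_)
    have h1 := P.H_base (T.paramInner k (T.jacc k))
    change P.H (T.paramInner k (T.jacc k)) (T.x k) ∈ nonposOrthant m
    simp only [paramInner] at h1 ⊢
    rw [h1]
    exact hT.feasible k
  have hxb : ∀ k, ‖xbar k‖ ≤ R + D := fun k => by
    have h2 := norm_add_le (T.x k) (xbar k - T.x k)
    rw [add_sub_cancel] at h2
    exact h2.trans (add_le_add (hR k).1 (hd k))
  refine ⟨fun k => ?_, fun k v hv => ?_⟩
  · have hL : ‖T.L k (T.jacc k)‖ ≤ m * B :=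
      norm_le_of_coord_le hB0 fun i => ⟨(hT.L_pos le_rfl i).le, (hB k _ le_rfl).2 i⟩
    have hV : ‖T.V k‖ ≤ R := (pi_norm_le_iff_of_nonneg hR0).2 (hR k).2.2
    simp only [param, paramInner, Prod.norm_mk, max_le_iff]
    have := hR k
    have := hQ k
    have := hxb k
    refine ⟨⟨?_, ?_, ?_, ?_, ?_⟩, ?_⟩ <;> linarith
  · have h1 : ‖v‖ ≤ |E| := (hE _ v (hxb k) hv).trans (le_abs_self E)
    refine ⟨by linarith, ?_⟩
    have h2 : ‖T.Q k (T.jacc k) (xbar k - T.x k)‖ ≤ (B + c.M) * D :=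
      (ContinuousLinearMap.le_opNorm _ _).trans
        (mul_le_mul (hQ k) (hd k) (norm_nonneg _) (by linarith))
    have h3 : gradTheta (T.param k) (xbar k) = T.ξ k + T.Q k (T.jacc k) (xbar k - T.x k) := rfl
    rw [h3]
    have h4 := norm_add_le (T.ξ k + T.Q k (T.jacc k) (xbar k - T.x k)) v
    have h5 := norm_add_le (T.ξ k) (T.Q k (T.jacc k) (xbar k - T.x k))
    have := (hR k).2.1
    linarith

theorem IsRun.exists_subSol (hP : P.Standing) (hT : T.IsRun P c) (k : ℕ) :
    ∃ x, P.IsSubSol (T.param k) x := by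
  refine P.exists_isSubSol hP.φ_convex (hT.mem_paramSet le_rfl) ⟨T.x k, ?_⟩ c.μmin_pos
    (hT.Q_inner_lower_min le_rfl)
  have h1 := P.H_base (T.paramInner k (T.jacc k))
  change P.H (T.paramInner k (T.jacc k)) (T.x k) ∈ nonposOrthant m
  simp only [paramInner] at h1 ⊢
  rw [h1]
  exact hT.feasible k

/-- The limit of a convergent sequence of accepted subproblems with bounded KKT multipliers. -/
theorem IsRun.stationary_of_tendsto (hP : P.Standing) (hT : T.IsRun P c) {xs : Vec n}
    (hxs : xs ∈ P.feasible) {χ : ℕ → ℕ} (hχ : StrictMono χ)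
    (hx : Tendsto (T.x ∘ χ) atTop (𝓝 xs))
    {us : Param n m} {xhat : Vec n} {xbar v : ℕ → Vec n} {lam : ℕ → Vec m}
    (hu : Tendsto (T.param ∘ χ) atTop (𝓝 us)) (hxbar : Tendsto xbar atTop (𝓝 xhat))
    (hv : ∀ k z, P.φ (xbar k) + inner ℝ (v k) (z - xbar k) ≤ P.φ z)
    (hlam : ∀ k, lam k ∈ normalCone (nonposOrthant m) (P.H (T.param (χ k)) (xbar k)))
    (hkkt : ∀ k, gradTheta (T.param (χ k)) (xbar k) + v k
      + gradH (T.param (χ k)) (xbar k) (lam k) = 0)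
    {C : ℝ} (hvC : ∀ k, ‖v k‖ ≤ C) (hlamC : ∀ k, ‖lam k‖ ≤ C) : P.Stationary xs := by
  have hg := hP.continuous_g
  have hφ : Continuous P.φ := hP.φ_convex.locallyLipschitz.continuous
  -- the inexact and the exact solutions have the same limit
  have hstep := (hT.tendsto_step hP).comp hχ.tendsto_atTop
  have hx' : Tendsto (fun k => T.x (χ k + 1)) atTop (𝓝 xs) := by
    have := (tendsto_zero_iff_norm_tendsto_zero.2 hstep).add hx
    rw [zero_add] at this
    exact this.congr fun k => by simp
  have hC0 : 0 ≤ C := (norm_nonneg _).trans (hvC 0)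
  -- In the error bound every term carries a factor of the step length; the other factors converge
  -- or are bounded by the multiplier bound.
  have herr : Tendsto (fun k => ‖T.x (χ k + 1) - xbar k‖ ^ 2) atTop (𝓝 0) := by
    have hlim : Tendsto (fun k => c.μmin⁻¹ * ((1 + m * C) * (c.βC / 2 *
        ‖T.x (χ k + 1) - T.x (χ k)‖ ^ 2) + c.βS * ‖T.x (χ k + 1) - T.x (χ k)‖ *
          ‖T.x (χ k + 1) - xbar k‖)) atTop
        (𝓝 (c.μmin⁻¹ * ((1 + m * C) * (c.βC / 2 * 0 ^ 2) + c.βS * 0 * ‖xs - xhat‖))) :=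
      (((((hstep.pow 2).const_mul _).const_mul _).add
        ((hstep.const_mul _).mul (hx'.sub hxbar).norm))).const_mul _
    simp only [ne_eq, OfNat.ofNat_ne_zero, not_false_eq_true, zero_pow, mul_zero, zero_mul,
      add_zero] at hlim
    refine squeeze_zero (fun k => by positivity) (fun k => ?_) hlim
    have hj : T.jacc (χ k) ≤ T.jacc (χ k) := le_rfl
    have hA := hT.inexact_C (χ k) _ hj
    have hB := hT.inexact_S (χ k) _ hj
    have hvy := (mem_limitingSubdiffReal_iff_of_convexOn hP.φ_convex).1 (hT.v_mem (χ k) _ hj)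
    have h1 := P.kkt_error_bound (hT.mem_paramSet hj) (hT.Q_inner_lower_min hj) (hv k) (hlam k)
      (hkkt k) hvy (hT.lam_nonneg (χ k) _ hj) hA hB
    rw [← hT.x_succ] at h1
    rw [← div_eq_inv_mul, le_div_iff₀ c.μmin_pos]
    have h2 : (1 + ∑ i, lam k i) * (c.βC / 2 * ‖T.x (χ k + 1) - T.x (χ k)‖ ^ 2) ≤
        (1 + m * C) * (c.βC / 2 * ‖T.x (χ k + 1) - T.x (χ k)‖ ^ 2) := by
      have := c.βC_pos
      gcongr
      exact (sum_le_card_mul_norm _).trans (by gcongr; exact hlamC k)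
    linarith
  have hxx : xs = xhat := by
    have h1 := ((hx'.sub hxbar).norm.pow 2)
    have h2 := tendsto_nhds_unique h1 herr
    exact sub_eq_zero.1 (norm_eq_zero.1 (pow_eq_zero_iff two_ne_zero |>.1 h2))
  subst hxx
  have hpair : ∀ k, (v k, lam k) ∈ Metric.closedBall (0 : Vec n × Vec m) C := fun k => by
    simpa [Prod.norm_mk] using ⟨hvC k, hlamC k⟩
  obtain ⟨⟨vs, lams⟩, -, ψ, hψ, hlim⟩ := tendsto_subseq_of_bounded Metric.isBounded_closedBall hpair
  have hvs : Tendsto (v ∘ ψ) atTop (𝓝 vs) := hlim.fst_nhds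
  have hls : Tendsto (lam ∘ ψ) atTop (𝓝 lams) := hlim.snd_nhds
  have hψt := hψ.tendsto_atTop
  obtain ⟨s, L, V, ξ, Q⟩ := us
  have hs : s = xs := tendsto_nhds_unique hu.fst_nhds hx
  have hV : Tendsto (fun k => T.V (χ k)) atTop (𝓝 V) := hu.snd_nhds.snd_nhds.fst_nhds
  have hξ : Tendsto (fun k => T.ξ (χ k)) atTop (𝓝 ξ) := hu.snd_nhds.snd_nhds.snd_nhds.fst_nhds
  subst hs
  have huψ := hu.comp hψt
  have hxψ := hxbar.comp hψt
  have hfin := hP.g0_finite hxs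
  refine ⟨hxs, ξ, ?_, vs, ?_, lams, ?_, V, fun i => ?_, ?_⟩
  · refine mem_limitingSubdiff_of_tendsto hfin.1 hfin.2 hx ?_ (fun k => hT.ξ_mem (χ k)) hξ
    have h1 := EReal.tendsto_coe.2 ((hP.g0_regular hxs).1.continuousAt.tendsto.comp hx)
    rw [EReal.coe_toReal hfin.1 hfin.2] at h1
    refine h1.congr fun k => ?_
    have h2 := hP.g0_finite (hT.feasible (χ k))
    exact EReal.coe_toReal h2.1 h2.2
  · refine (mem_limitingSubdiffReal_iff_of_convexOn hP.φ_convex).2 fun z => ?_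
    refine le_of_tendsto (((hφ.tendsto s).comp hxψ).add (hvs.inner (tendsto_const_nhds.sub hxψ)))
      (Eventually.of_forall fun k => hv (ψ k) z)
  · have h1 := mem_normalCone_nonposOrthant_of_tendsto (fun k => hlam (ψ k)) hls
      (P.tendsto_H hg huψ hxψ)
    rwa [P.H_base (s, L, V, ξ, Q)] at h1
  · refine mem_limitingSubdiff_of_tendsto (h := fun z => (P.g z i : EReal)) (EReal.coe_ne_top _)
      (EReal.coe_ne_bot _) hx ?_
      (fun k => hT.V_mem (χ k) i) (tendsto_pi_nhds.1 hV i)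
    have : Continuous fun z => (P.g z i : EReal) :=
      continuous_coe_real_ereal.comp (by fun_prop)
    exact (this.tendsto s).comp hx
  -- The limiting base point and solution are now the same `s`, so the `Q` and `L` terms of the
  -- limit equation drop out.
  · have h1 := ((tendsto_gradTheta huψ hxψ).add hvs).add (tendsto_gradH huψ hxψ hls)
    have h2 := tendsto_nhds_unique h1 (tendsto_const_nhds.congr fun k => (hkkt (ψ k)).symm)
    simpa [gradTheta, gradH, gradG] using h2

theorem IsRun.stationary_of_cluster (hP : P.Standing) (hT : T.IsRun P c)
    (hbdd : Bornology.IsBounded (Set.range T.x)) (hbmp : T.BMPAtClusterPoints P) {xs : Vec n}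
    (hxs : xs ∈ clusterSet T.x) : P.Stationary xs := by
  obtain ⟨ψ, hψ, hlim⟩ := MapClusterPt.tendsto_subseq hxs
  have hfeas : xs ∈ P.feasible :=
    hP.isClosed_feasible.mem_of_tendsto hlim (Eventually.of_forall fun k => hT.feasible _)
  choose xbar hxbar using hT.exists_subSol hP
  obtain ⟨C, hC⟩ := hT.exists_subSol_bound hP hbdd
  obtain ⟨hC1, hC2⟩ := hC xbar hxbar
  have : ProperSpace (Vec n →L[ℝ] Vec n) := FiniteDimensional.proper ℝ _
  obtain ⟨⟨us, xhat⟩, -, η, hη, hw⟩ := tendsto_subseq_of_bounded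
    (x := fun k => (T.param (ψ k), xbar (ψ k))) (Metric.isBounded_closedBall (x := 0) (r := C))
    (fun k => by simpa using hC1 (ψ k))
  have hclus : (us, xhat) ∈ clusterSet (fun k => (T.param k, xbar k)) :=
    (hw.mapClusterPt).of_comp ((hψ.comp hη).tendsto_atTop)
  obtain ⟨κ, hκ, U, hU, W, hW, hmul⟩ := hbmp xbar hxbar _ hclus
  choose v hv hvN using fun k => (hxbar k).exists_kkt P hP.φ_convex (hT.mem_paramSet le_rfl)
  have hev := (hw.fst_nhds.eventually hU).and (hw.snd_nhds.eventually hW)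
  obtain ⟨N, hN⟩ := eventually_atTop.1 hev
  -- The shift by `N` puts every term in the neighbourhoods `U` and `W`, so multipliers exist for
  -- all indices.
  set χ : ℕ → ℕ := fun k => ψ (η (k + N)) with hχ
  have hχm : StrictMono χ := fun a b hab => hψ (hη (by omega))
  have hmul' : ∀ k, ∃ lam ∈ P.Lam (T.param (χ k)) (xbar (χ k))
      (-(gradTheta (T.param (χ k)) (xbar (χ k)) + v (χ k))),
      ‖lam‖ ≤ κ * ‖-(gradTheta (T.param (χ k)) (xbar (χ k)) + v (χ k))‖ := fun k =>
    hmul _ ⟨(hN (k + N) (by omega)).1, hT.mem_paramSet le_rfl⟩ _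
      ⟨(hN (k + N) (by omega)).2, (hxbar _).1⟩ _ (hvN _)
  choose lam hlam hlamb using hmul'
  have hshift := tendsto_add_atTop_nat N
  have hC0 : 0 ≤ C := (norm_nonneg _).trans (hC1 0)
  refine hT.stationary_of_tendsto hP hfeas hχm ((hlim.comp hη.tendsto_atTop).comp hshift)
    (hw.fst_nhds.comp hshift) (hw.snd_nhds.comp hshift) (v := v ∘ χ) (lam := lam)
    (fun k => hv _) (fun k => (hlam k).1) (fun k => ?_) (C := C + κ * C) (fun k => ?_) fun k => ?_
  · change gradTheta (T.param (χ k)) (xbar (χ k)) + v (χ k)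
      + gradH (T.param (χ k)) (xbar (χ k)) (lam k) = 0
    rw [(hlam k).2, add_neg_cancel]
  · have := (hC2 _ _ (hv (χ k))).1
    have : 0 ≤ κ * C := by positivity
    simp only [Function.comp]
    linarith
  · have h1 := (hC2 _ _ (hv (χ k))).2
    rw [← norm_neg] at h1
    have := mul_le_mul_of_nonneg_left h1 hκ.le
    linarith [hlamb k]

end Trace

end MBA

theorem theorem4p1 {n m : ℕ} (P : MBA.Problem n m) (hP : P.Standing) (c : MBA.Constants)
    (T : MBA.Trace n m) (hT : T.IsRun P c)
    (hsub : T.SubproblemsSubregular P)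
    (hbdd : Bornology.IsBounded (Set.range T.x))
    (hbmp : T.BMPAtClusterPoints P) :
    (∀ x ∈ MBA.clusterSet T.x, P.Stationary x) ∧
    ∃ ϖ : ℝ, Filter.Tendsto (fun k => P.F (T.x k)) Filter.atTop (nhds (ϖ : EReal)) ∧
      ∀ x ∈ MBA.clusterSet T.x, P.F x = (ϖ : EReal) := by
  have hst : ∀ x ∈ MBA.clusterSet T.x, P.Stationary x := fun x hx =>
    hT.stationary_of_cluster hP hbdd hbmp hx
  obtain ⟨ϖ, hϖ⟩ := hT.exists_objective_limit hP
  refine ⟨hst, ϖ, ?_, fun x hx => ?_⟩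
  · exact (EReal.tendsto_coe.2 hϖ).congr fun k => (hP.F_eq (hT.feasible k)).symm
  -- At a feasible point `g0` and `φ` are continuous, so the objective values along the subsequence
  -- identify `F x` with the limit.
  · obtain ⟨ψ, hψ, hlim⟩ := MapClusterPt.tendsto_subseq hx
    have hfeas := (hst x hx).1
    rw [hP.F_eq hfeas, EReal.coe_eq_coe_iff]
    have hφ : Continuous P.φ := hP.φ_convex.locallyLipschitz.continuous
    exact tendsto_nhds_unique (((hP.g0_regular hfeas).1.continuousAt.tendsto.comp hlim).add
      ((hφ.tendsto x).comp hlim)) (hϖ.comp hψ.tendsto_atTop)
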